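/- Let $d\ge 2$, $s\ge 1$, $n\ge 1$ be integers, $\beta>-d-s$, $\lambda_0,\dots,\lambda_{s-1}>0$, and let $\eta\in C^\infty([0,\infty))$ satisfy $\eta=1$ on $[0,1]$ and $\eta=0$ on $(2,\infty)$. Let $\mathbb V_0^{d+1}=\{(x,t)\in\mathbb R^d\times[0,1]:\|x\|=t\}$, write $\int_{\mathbb V_0^{d+1}} g\,d\mathsf m=\int_0^1t^{d-1}\int_{\mathbb S^{d-1}}g(t\xi,t)\,d\sigma(\xi)\,dt$, let $\omega_d=\sigma(\mathbb S^{d-1})$, and let $\partial_t$ be the partial derivative in the last variable ($x$ fixed). Put $$\langle f,g\rangle_{\beta,\gamma}=b_{\beta,\gamma}\int_{\mathbb V_0^{d+1}}fg\,t^\beta(1-t)^\gamma\,d\mathsf m\quad(\beta>-d,\ \gamma>-1),\qquad \langle 1,1\rangle_{\beta,\gamma}=1,$$ $$\langle f,g\rangle_{\beta,-s}=\frac1{\omega_d}\int_{\mathbb V_0^{d+1}}\partial_t^sf\,\partial_t^sg\;t^{\beta+s}\,d\mathsf m+\sum_{k=0}^{s-1}\frac{\lambda_k}{\omega_d}\int_{\mathbb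 S^{d-1}}\partial_t^kf(\xi,1)\,\partial_t^kg(\xi,1)\,d\sigma(\xi).$$ A polynomial of degree at most $n$ on the cone is always written as a linear combination of functions $t^jY(x)$, where $Y$ is a solid harmonic (a homogeneous harmonic polynomial) of degree $m$ and $j+m\le n$; this representation is unique, and $\partial_t$ and values off the cone refer to it. For either inner product, the orthogonal polynomials of degree $n$ are those polynomials of degree at most $n$ that are orthogonal to all polynomials of degree at most $n-1$; let $\operatorname{proj}_n^{\beta,\gamma}$ and $\operatorname{proj}_n^{\beta,-s}$ denote the orthogonal projections onto these spaces. Let $\operatorname{proj}_j^{\mathbb S^{d-1}}$ be the $L^2(\mathbb S^{d-1})$-orthogonal projection onto the spherical harmonics of degree $j$, its values being extended to $\mathbb R^d$ as solid harmonics of degree $j$. Define $$\mathsf Q_{n,\eta}^{(\beta,-s)}f=\sum_{k=0}^{2n}\eta\Big(\frac kn\Big)\operatorname{proj}_k^{\beta,-s}f,\qquad \mathsf Q_{n-s,\eta}^{(\beta+s,0)}g=\sum_{j=0}^{2n-s}\eta\Big(\frac{j+s}n\Big)\operatorname{proj}_j^{\beta+s,0}g,$$ $$\mathsf Q_{n-m,\eta}^{\mathbb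 S^{d-1}}g=\sum_{j=0}^{2n-m}\eta\Big(\frac{j+m}n\Big)\operatorname{proj}_j^{\mathbb S^{d-1}}g$$ (empty sums are $0$). **Theorem.** Let $f$ be of class $C^s$ on an open neighbourhood of $\{(x,t):\|x\|\le t\le1\}$. Then, for every $(x,t)\in\mathbb V_0^{d+1}$, $$\begin{aligned}f(x,t)-\mathsf Q_{n,\eta}^{(\beta,-s)}f(x,t)=\;&\sum_{m=0}^{s-1}\frac{(t-1)^m}{m!}\Big[\partial_t^mf(x,1)-\mathsf Q_{n-m,\eta}^{\mathbb S^{d-1}}\big[\partial_t^mf(\cdot,1)\big](x)\Big]\\&+(-1)^s\int_t^1\frac{(v-t)^{s-1}}{(s-1)!}\Big[\partial_t^sf(x,v)-\mathsf Q_{n-s,\eta}^{(\beta+s,0)}\big(\partial_t^sf\big)(x,v)\Big]\,dv.\end{aligned}$$ -/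

import Mathlib

open scoped ContDiff

noncomputable section

namespace ConeSobolev

open MeasureTheory

/-- Euclidean space `ℝ^d`. -/
abbrev E (d : ℕ) : Type := EuclideanSpace ℝ (Fin d)

/-- The conic surface `V_0^{d+1} = {(x,t) : ‖x‖ = t, 0 ≤ t ≤ 1}`. -/
def cone (d : ℕ) : Set (E d × ℝ) := {p | ‖p.1‖ = p.2 ∧ 0 ≤ p.2 ∧ p.2 ≤ 1}

/-- The solid cone `{(x,t) : ‖x‖ ≤ t ≤ 1}`. -/
def solidCone (d : ℕ) : Set (E d × ℝ) := {p | ‖p.1‖ ≤ p.2 ∧ p.2 ≤ 1}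

/-- `∂_t^k f`, where `∂_t` is the partial derivative in the last variable (`x` is kept fixed). -/
def tderiv {d : ℕ} (k : ℕ) (f : E d × ℝ → ℝ) : E d × ℝ → ℝ :=
  fun p => iteratedDeriv k (fun τ => f (p.1, τ)) p.2

/-! ### The unit sphere and spherical harmonics -/

/-- The surface measure `σ` of the unit sphere of `ℝ^d`. -/
def sphMeasure (d : ℕ) : Measure (Metric.sphere (0 : E d) 1) :=
  (volume : Measure (E d)).toSphere

/-- `∫_{S^{d-1}} g dσ` for a function `g` that is defined on `ℝ^d`. -/
def sphInt (d : ℕ) (g : E d → ℝ) : ℝ := ∫ ξ, g (ξ : E d) ∂(sphMeasure d)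

/-- The surface area `ω_d` of the unit sphere. -/
def sphArea (d : ℕ) : ℝ := (sphMeasure d).real Set.univ

/-- The normalized `L²` inner product of the unit sphere. -/
def sphInner (d : ℕ) (g h : E d → ℝ) : ℝ := (1 / sphArea d) * sphInt d (fun ξ => g ξ * h ξ)

/-- The Laplace operator on polynomials in `d` variables. -/
def laplacian (d : ℕ) (P : MvPolynomial (Fin d) ℝ) : MvPolynomial (Fin d) ℝ :=
  ∑ i, MvPolynomial.pderiv i (MvPolynomial.pderiv i P)

/-- The solid harmonics of degree `m`, as functions on `ℝ^d`: homogeneous polynomials of degree `m`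
that are annihilated by the Laplace operator. Their restrictions to the unit sphere are the
spherical harmonics of degree `m`; by homogeneity, a spherical harmonic determines its solid
harmonic. -/
def solidHarmonics (d m : ℕ) : Set (E d → ℝ) :=
  {Y | ∃ P : MvPolynomial (Fin d) ℝ, P.IsHomogeneous m ∧ laplacian d P = 0 ∧
    Y = fun x => MvPolynomial.eval (fun i => x i) P}

/-! ### Orthogonal projections -/

open Classical in
/-- The orthogonal projection of `f` onto `V` with respect to the symmetric form `B`: the element
`p` of `V` with `B (f - p) q = 0` for all `q ∈ V` (and `0` if there is no such `p`). -/
def orthProj {X : Type} (B : (X → ℝ) → (X → ℝ) → ℝ) (V : Set (X → ℝ)) (f : X → ℝ) : X → ℝ :=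
  if h : ∃ p ∈ V, ∀ q ∈ V, B (f - p) q = 0 then h.choose else 0

/-- The projection `proj_m^{S^{d-1}}` of `L²(S^{d-1})` onto the spherical harmonics of degree `m`.
The value is given as a solid harmonic, a function on `ℝ^d`; only the values of `g` on the unit
sphere matter. -/
def sphProj (d m : ℕ) (g : E d → ℝ) : E d → ℝ := orthProj (sphInner d) (solidHarmonics d m) g

/-! ### Polynomials and orthogonal polynomials on the conic surface -/

/-- Polynomials of degree less than `N` on the conic surface. On the surface `‖x‖² = t²`, so that
every polynomial has a unique representative that is a sum of products of a power of `t` and a solid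
harmonic in `x`; the derivative `∂_t`, and values off the surface, refer to this representative. -/
def conePoly (d N : ℕ) : Submodule ℝ (E d × ℝ → ℝ) :=
  Submodule.span ℝ {g | ∃ (j m : ℕ) (Y : E d → ℝ), j + m < N ∧ Y ∈ solidHarmonics d m ∧
    g = fun p => p.2 ^ j * Y p.1}

/-- The orthogonal polynomials of degree `n` on the conic surface for the form `B`: polynomials of
degree at most `n` that are orthogonal to all polynomials of lower degree. -/
def orthPoly (d : ℕ) (B : (E d × ℝ → ℝ) → (E d × ℝ → ℝ) → ℝ) (n : ℕ) : Set (E d × ℝ → ℝ) :=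
  {p | p ∈ conePoly d (n + 1) ∧ ∀ q ∈ conePoly d n, B p q = 0}

/-- `∫_{V_0^{d+1}} g dm`. -/
def coneInt (d : ℕ) (g : E d × ℝ → ℝ) : ℝ :=
  ∫ t in (0 : ℝ)..1, t ^ (d - 1) * sphInt d (fun ξ => g (t • ξ, t))

/-- The normalization constant `b_{β,γ} = c_{β+d-1,γ} / ω_d`, for which `⟨1,1⟩_{β,γ} = 1`. -/
def coneConst (d : ℕ) (β γ : ℝ) : ℝ :=
  (1 / sphArea d) * (Real.Gamma (β + d + γ + 1) / (Real.Gamma (β + d) * Real.Gamma (γ + 1)))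

/-- The inner product `⟨f,g⟩_{β,γ}` with the Jacobi weight `t^β (1-t)^γ`. -/
def coneInner (d : ℕ) (β γ : ℝ) (f g : E d × ℝ → ℝ) : ℝ :=
  coneConst d β γ * coneInt d (fun p => f p * g p * (p.2 ^ β * (1 - p.2) ^ γ))

/-- The Sobolev inner product `⟨f,g⟩_{β,-s}` with the constants `lam 0, …, lam (s-1)`. -/
def sobInner (d s : ℕ) (β : ℝ) (lam : ℕ → ℝ) (f g : E d × ℝ → ℝ) : ℝ :=
  (1 / sphArea d) * coneInt d (fun p => tderiv s f p * tderiv s g p * p.2 ^ (β + s)) +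
    ∑ k ∈ Finset.range s,
      (lam k / sphArea d) * sphInt d (fun ξ => tderiv k f (ξ, 1) * tderiv k g (ξ, 1))

/-- The projection `proj_n^{β,γ}` onto the orthogonal polynomials of degree `n`. -/
def coneProj (d : ℕ) (β γ : ℝ) (n : ℕ) (f : E d × ℝ → ℝ) : E d × ℝ → ℝ :=
  orthProj (coneInner d β γ) (orthPoly d (coneInner d β γ) n) f

/-- The projection `proj_n^{β,-s}` onto the Sobolev orthogonal polynomials of degree `n`. -/
def sobProj (d s : ℕ) (β : ℝ) (lam : ℕ → ℝ) (n : ℕ) (f : E d × ℝ → ℝ) : E d × ℝ → ℝ :=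
  orthProj (sobInner d s β lam) (orthPoly d (sobInner d s β lam) n) f

/-! ### Near best approximation operators -/

/-- Admissible cut-off functions on `[0,∞)`: smooth, equal to `1` on `[0,1]`, supported on
`[0,2]`. -/
structure IsAdmissibleCutoff (η : ℝ → ℝ) : Prop where
  smooth : ContDiffOn ℝ ∞ η (Set.Ici 0)
  eq_one : ∀ t, 0 ≤ t → t ≤ 1 → η t = 1
  eq_zero : ∀ t, 2 < t → η t = 0

/-- `Q_{n,η}^{(β,-s)} f = ∑_{k=0}^{2n} η(k/n) proj_k^{β,-s} f`. -/
def sobQ (d s : ℕ) (β : ℝ) (lam : ℕ → ℝ) (η : ℝ → ℝ) (n : ℕ) (f : E d × ℝ → ℝ) : E d × ℝ → ℝ :=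
  ∑ k ∈ Finset.range (2 * n + 1), η ((k : ℝ) / n) • sobProj d s β lam k f

/-- `Q_{n-m,η}^{β,γ} g = ∑_{j=0}^{2n-m} η((j+m)/n) proj_j^{β,γ} g` (zero if `m > 2n`). -/
def coneQ (d : ℕ) (β γ : ℝ) (η : ℝ → ℝ) (n m : ℕ) (g : E d × ℝ → ℝ) : E d × ℝ → ℝ :=
  ∑ j ∈ Finset.range (2 * n + 1 - m), η (((j : ℝ) + m) / n) • coneProj d β γ j g

/-- `Q_{n-m,η}^{S^{d-1}} g = ∑_{j=0}^{2n-m} η((j+m)/n) proj_j^{S^{d-1}} g` (zero if `m > 2n`), as a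
sum of solid harmonics. -/
def sphQ (d : ℕ) (η : ℝ → ℝ) (n m : ℕ) (g : E d → ℝ) : E d → ℝ :=
  ∑ j ∈ Finset.range (2 * n + 1 - m), η (((j : ℝ) + m) / n) • sphProj d j g

end ConeSobolev

end

/-!
For polynomials, `f ↦ ∂_t ^ s f` together with the traces of `∂_t ^ m f`, `m < s`, on the base
`t = 1` is a bijection onto independent data: an arbitrary polynomial of degree at most `n - s` and
arbitrary sums of solid harmonics of degrees at most `n - m`. In these coordinates the Sobolev form
is an orthogonal sum of the conic inner product with parameters `(β + s, 0)` and of the inner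
products of `L²(S^{d-1})`, so its orthogonal projection of degree `k` is carried to the projection
of degree `k - s` on the cone and to the projections of degree `k - m` on the sphere. The latter are
determined by orthogonality because solid harmonics of different degrees are orthogonal; this is
obtained by integrating by parts against a Gaussian and using Euler's identity. The theorem is then
Taylor's formula at `t = 1`, with integral remainder, for `f - Q f`.
-/

noncomputable section

namespace ConeSobolev

open MeasureTheory

/-! ### Gaussian integrals of polynomials -/

section Gaussian

variable {d m l : ℕ} {P Q : MvPolynomial (Fin d) ℝ}

/-- The algebra homomorphism that sends a polynomial in `d` variables to its function on `ℝ^d`. -/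
def polyFun (d : ℕ) : MvPolynomial (Fin d) ℝ →ₐ[ℝ] (E d → ℝ) :=
  MvPolynomial.aeval fun i x => x i

lemma polyFun_apply (P : MvPolynomial (Fin d) ℝ) (x : E d) :
    polyFun d P x = MvPolynomial.eval (fun i => x i) P := by
  simpa [polyFun, MvPolynomial.aeval_eq_eval] using
    MvPolynomial.comp_aeval_apply (fun i (x : E d) => x i) (Pi.evalAlgHom ℝ (fun _ : E d => ℝ) x) P

@[simp]
lemma polyFun_X (i : Fin d) (x : E d) : polyFun d (MvPolynomial.X i) x = x i := by
  simp [polyFun_apply]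

lemma contDiff_polyFun (P : MvPolynomial (Fin d) ℝ) {k : WithTop ℕ∞} :
    ContDiff ℝ k (polyFun d P) := by
  rw [funext (polyFun_apply P)]
  exact (AnalyticOnNhd.aeval_mvPolynomial (f := fun (x : E d) (i : Fin d) => x i)
    (fun i => (EuclideanSpace.proj i : E d →L[ℝ] ℝ).analyticOnNhd Set.univ) P).contDiff

lemma polyFun_smul (hP : P.IsHomogeneous m) (r : ℝ) (x : E d) :
    polyFun d P (r • x) = r ^ m * polyFun d P x := by
  simp only [polyFun_apply, MvPolynomial.eval_eq', Finset.mul_sum]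
  refine Finset.sum_congr rfl fun u hu => ?_
  have degree_eq : ∑ i, u i = m := by
    rw [← Finsupp.degree_eq_sum, Finsupp.degree_eq_weight_one]
    exact hP (MvPolynomial.mem_support_iff.mp hu)
  simp only [PiLp.smul_apply, smul_eq_mul, mul_pow, Finset.prod_mul_distrib,
    Finset.prod_pow_eq_pow_sum, degree_eq]
  ring

lemma hasLineDerivAt_polyFun (P : MvPolynomial (Fin d) ℝ) (i : Fin d) (x : E d) :
    HasLineDerivAt ℝ (polyFun d P) (polyFun d (MvPolynomial.pderiv i P) x) x
      (EuclideanSpace.single i 1) := by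
  unfold HasLineDerivAt
  induction P using MvPolynomial.induction_on with
  | C a => simpa using hasDerivAt_const (0 : ℝ) a
  | add P Q hP hQ => simpa [Pi.add_def] using hP.add hQ
  | mul_X P j hP =>
    have coord : HasDerivAt (fun t : ℝ => (x + t • EuclideanSpace.single i (1 : ℝ)) j)
        (EuclideanSpace.single i (1 : ℝ) j) 0 := by
      simpa using ((hasDerivAt_id (0 : ℝ)).mul_const (EuclideanSpace.single i (1 : ℝ) j)).const_add
        (x j)
    simp only [map_mul, Pi.mul_apply, polyFun_X]
    refine (hP.mul coord).congr_deriv ?_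
    by_cases hij : j = i
    · subst hij
      simp [mul_comm, add_comm]
    · simp [hij, mul_comm]

/-- The Gaussian weight `exp (-‖x‖² / 2)`. -/
def gauss (d : ℕ) (x : E d) : ℝ := Real.exp (-(1 / 2) * ‖x‖ ^ 2)

lemma gauss_eq_prod (x : E d) : gauss d x = ∏ i, Real.exp (-(1 / 2) * x i ^ 2) := by
  simp only [gauss, ← Real.exp_sum, EuclideanSpace.norm_sq_eq, ← Finset.mul_sum, Real.norm_eq_abs,
    sq_abs]

lemma hasLineDerivAt_gauss (i : Fin d) (x : E d) :
    HasLineDerivAt ℝ (gauss d) (-(x i * gauss d x)) x (EuclideanSpace.single i 1) := by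
  have h := ((hasStrictFDerivAt_norm_sq x).hasFDerivAt.const_mul (-(1 / 2))).exp.hasLineDerivAt
    (EuclideanSpace.single i 1)
  refine h.congr_deriv ?_
  simp [gauss, EuclideanSpace.inner_single_right]
  ring

lemma integrable_polyFun_mul_gauss (P : MvPolynomial (Fin d) ℝ) :
    Integrable (fun x => polyFun d P x * gauss d x) := by
  induction P using MvPolynomial.induction_on' with
  | add P Q hP hQ => simpa [add_mul, Pi.add_def] using hP.add hQ
  | monomial u a =>
    have factor (i : Fin d) : Integrable fun y : ℝ => y ^ u i * Real.exp (-(1 / 2) * y ^ 2) := by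
      simpa using integrable_rpow_mul_exp_neg_mul_sq (b := 1 / 2) (by norm_num)
        (neg_one_lt_zero.trans_le (Nat.cast_nonneg (u i)))
    rw [← (EuclideanSpace.volume_preserving_symm_measurableEquiv_toLp
      (Fin d)).symm.integrable_comp_emb (MeasurableEquiv.measurableEmbedding _)]
    refine ((Integrable.fintype_prod factor).const_mul a).congr (.of_forall fun x => ?_)
    simp [polyFun_apply, gauss_eq_prod, MvPolynomial.eval_monomial, Finsupp.prod_fintype,
      Finset.prod_mul_distrib, mul_assoc]

/-- Integration of polynomials against the Gaussian weight. -/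
def gaussInt (d : ℕ) : MvPolynomial (Fin d) ℝ →ₗ[ℝ] ℝ where
  toFun P := ∫ x, polyFun d P x * gauss d x
  map_add' P Q := by
    simp only [map_add, Pi.add_apply, add_mul]
    exact integral_add (integrable_polyFun_mul_gauss P) (integrable_polyFun_mul_gauss Q)
  map_smul' c P := by
    simp only [map_smul, Pi.smul_apply, smul_eq_mul, mul_assoc, RingHom.id_apply]
    exact integral_const_mul c _

lemma gaussInt_apply (P : MvPolynomial (Fin d) ℝ) :
    gaussInt d P = ∫ x, polyFun d P x * gauss d x := rfl

lemma gaussInt_pderiv (i : Fin d) (P : MvPolynomial (Fin d) ℝ) :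
    gaussInt d (MvPolynomial.pderiv i P) = gaussInt d (MvPolynomial.X i * P) := by
  have by_parts := integral_bilinear_hasLineDerivAt_right_eq_neg_left_of_integrable
    (μ := (volume : Measure (E d))) (B := ContinuousLinearMap.mul ℝ ℝ)
    (integrable_polyFun_mul_gauss _)
    ((integrable_polyFun_mul_gauss (MvPolynomial.X i * P)).neg.congr (.of_forall fun x => by
      simp [mul_left_comm, mul_assoc]))
    (integrable_polyFun_mul_gauss P)
    (fun x _ => hasLineDerivAt_polyFun P i x) (fun x _ => hasLineDerivAt_gauss i x)
  simp only [ContinuousLinearMap.mul_apply', mul_neg, integral_neg, neg_inj] at by_parts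
  simp only [gaussInt_apply, map_mul, Pi.mul_apply, polyFun_X, ← by_parts, mul_left_comm, mul_assoc]

lemma gaussInt_mul_of_laplacian_eq_zero (hP : P.IsHomogeneous m) (hP0 : laplacian d P = 0)
    (Q : MvPolynomial (Fin d) ℝ) :
    m * gaussInt d (P * Q) =
      ∑ i, gaussInt d (MvPolynomial.pderiv i P * MvPolynomial.pderiv i Q) := by
  have by_parts (i : Fin d) : gaussInt d (MvPolynomial.X i * MvPolynomial.pderiv i P * Q) =
      gaussInt d (MvPolynomial.pderiv i (MvPolynomial.pderiv i P) * Q) +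
        gaussInt d (MvPolynomial.pderiv i P * MvPolynomial.pderiv i Q) := by
    rw [mul_assoc, ← gaussInt_pderiv, ← map_add, Derivation.leibniz, smul_eq_mul, smul_eq_mul,
      add_comm, mul_comm Q]
  calc m * gaussInt d (P * Q)
      = gaussInt d ((∑ i, MvPolynomial.X i * MvPolynomial.pderiv i P) * Q) := by
        rw [hP.sum_X_mul_pderiv, smul_mul_assoc, map_nsmul, nsmul_eq_mul]
    _ = gaussInt d (laplacian d P * Q) +
          ∑ i, gaussInt d (MvPolynomial.pderiv i P * MvPolynomial.pderiv i Q) := by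
        simp only [laplacian, Finset.sum_mul, map_sum, by_parts, Finset.sum_add_distrib]
    _ = _ := by rw [hP0, zero_mul, map_zero, zero_add]

lemma gaussInt_mul_eq_zero (hml : m ≠ l) (hP : P.IsHomogeneous m) (hP0 : laplacian d P = 0)
    (hQ : Q.IsHomogeneous l) (hQ0 : laplacian d Q = 0) : gaussInt d (P * Q) = 0 := by
  have eq_of_degree : (m : ℝ) * gaussInt d (P * Q) = l * gaussInt d (P * Q) := by
    rw [gaussInt_mul_of_laplacian_eq_zero hP hP0, mul_comm P Q,
      gaussInt_mul_of_laplacian_eq_zero hQ hQ0]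
    simp only [mul_comm]
  by_contra h
  exact hml (by exact_mod_cast mul_right_cancel₀ h eq_of_degree)

end Gaussian

theorem integral_mul_fun_norm_addHaar {F : Type*} [NormedAddCommGroup F] [NormedSpace ℝ F]
    [FiniteDimensional ℝ F] [Nontrivial F] [MeasurableSpace F] [BorelSpace F] (μ : Measure F)
    [μ.IsAddHaarMeasure] {m : ℕ} {h : F → ℝ}
    (hh : ∀ r : ℝ, 0 < r → ∀ x, h (r • x) = r ^ m * h x) (φ : ℝ → ℝ) :
    ∫ x, h x * φ ‖x‖ ∂μ = (∫ ξ : Metric.sphere (0 : F) 1, h ξ ∂μ.toSphere) *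
      ∫ r in Set.Ioi (0 : ℝ), r ^ (Module.finrank ℝ F - 1 + m) * φ r := by
  have radial : ∫ r : Set.Ioi (0 : ℝ), (r : ℝ) ^ m * φ r
      ∂.volumeIoiPow (Module.finrank ℝ F - 1) =
      ∫ r in Set.Ioi (0 : ℝ), r ^ (Module.finrank ℝ F - 1 + m) * φ r := by
    simp only [Measure.volumeIoiPow, ENNReal.ofReal]
    rw [integral_withDensity_eq_integral_smul
        (measurable_subtype_coe.pow_const _).real_toNNReal,
      integral_subtype_comap measurableSet_Ioi
        fun r : ℝ => Real.toNNReal (r ^ (Module.finrank ℝ F - 1)) • (r ^ m * φ r)]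
    refine setIntegral_congr_fun measurableSet_Ioi fun r hr => ?_
    rw [NNReal.smul_def, Real.coe_toNNReal _ (pow_nonneg (le_of_lt hr) _), smul_eq_mul, pow_add,
      mul_assoc]
  let g (p : Metric.sphere (0 : F) 1 × Set.Ioi (0 : ℝ)) : ℝ := h p.1 * ((p.2 : ℝ) ^ m * φ p.2)
  calc ∫ x, h x * φ ‖x‖ ∂μ
      = ∫ x : ({(0)}ᶜ : Set F), h x * φ ‖(x : F)‖ ∂μ.comap (↑) := by
        rw [integral_subtype_comap (measurableSet_singleton _).compl fun x => h x * φ ‖x‖,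
          restrict_compl_singleton]
    _ = ∫ x : ({(0)}ᶜ : Set F), g (homeomorphUnitSphereProd F x) ∂μ.comap (↑) := by
        refine integral_congr_ae (.of_forall fun x => ?_)
        have hx : 0 < ‖(x : F)‖ := norm_pos_iff.mpr x.2
        simp only [g, homeomorphUnitSphereProd_apply_fst_coe,
          homeomorphUnitSphereProd_apply_snd_coe, hh _ (inv_pos.mpr hx), inv_pow]
        field_simp
    _ = (∫ ξ : Metric.sphere (0 : F) 1, h ξ ∂μ.toSphere) *
          ∫ r : Set.Ioi (0 : ℝ), (r : ℝ) ^ m * φ r ∂.volumeIoiPow (Module.finrank ℝ F - 1) :=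
        (μ.measurePreserving_homeomorphUnitSphereProd.integral_comp
          (Homeomorph.measurableEmbedding _) _).trans <|
            integral_prod_mul (fun ξ : Metric.sphere (0 : F) 1 => h ξ)
              (fun r : Set.Ioi (0 : ℝ) => (r : ℝ) ^ m * φ r)
    _ = _ := by rw [radial]

lemma integral_pow_mul_exp_neg_half_sq_pos (k : ℕ) :
    0 < ∫ r in Set.Ioi (0 : ℝ), r ^ k * Real.exp (-(1 / 2) * r ^ 2) := by
  have eval := integral_rpow_mul_exp_neg_mul_rpow (p := 2) (q := k) (b := 1 / 2) two_pos
    (neg_one_lt_zero.trans_le k.cast_nonneg) (by norm_num)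
  simp only [Real.rpow_natCast, Real.rpow_ofNat] at eval
  rw [eval]
  positivity

lemma sphInt_polyFun_mul_eq_zero {d m l : ℕ} [NeZero d] (hml : m ≠ l)
    {P Q : MvPolynomial (Fin d) ℝ} (hP : P.IsHomogeneous m) (hP0 : laplacian d P = 0)
    (hQ : Q.IsHomogeneous l) (hQ0 : laplacian d Q = 0) :
    sphInt d (fun ξ => polyFun d P ξ * polyFun d Q ξ) = 0 := by
  have polar := integral_mul_fun_norm_addHaar (volume : Measure (E d))
    (fun r _ => polyFun_smul (hP.mul hQ) r) (fun r => Real.exp (-(1 / 2) * r ^ 2))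
  have gauss_zero := gaussInt_mul_eq_zero hml hP hP0 hQ hQ0
  rw [gaussInt_apply] at gauss_zero
  simp only [gauss] at gauss_zero
  rw [polar, map_mul] at gauss_zero
  exact (mul_eq_zero.mp gauss_zero).resolve_right (integral_pow_mul_exp_neg_half_sq_pos _).ne'

/-! ### Orthogonal projections for symmetric forms -/

/-- `B` is a symmetric bilinear form on the space `W` of functions; nothing is required of its
values outside `W`, where an integral may be undefined. -/
structure IsSymmBilinOn {X : Type*} (B : (X → ℝ) → (X → ℝ) → ℝ) (W : Submodule ℝ (X → ℝ)) :
    Prop where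
  symm : ∀ f ∈ W, ∀ g ∈ W, B f g = B g f
  add_left : ∀ f ∈ W, ∀ g ∈ W, ∀ h ∈ W, B (f + g) h = B f h + B g h
  smul_left : ∀ (c : ℝ), ∀ f ∈ W, ∀ h ∈ W, B (c • f) h = c * B f h

namespace IsSymmBilinOn

section Form

variable {X : Type*} {B : (X → ℝ) → (X → ℝ) → ℝ} {W V : Submodule ℝ (X → ℝ)} {f g h : X → ℝ}

lemma mono (hB : IsSymmBilinOn B W) (hV : V ≤ W) : IsSymmBilinOn B V where
  symm f hf g hg := hB.symm f (hV hf) g (hV hg)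
  add_left f hf g hg h hh := hB.add_left f (hV hf) g (hV hg) h (hV hh)
  smul_left c f hf h hh := hB.smul_left c f (hV hf) h (hV hh)

/-- The restriction of `B` to `W`, as a bilinear form. -/
def toBilinForm (hB : IsSymmBilinOn B W) : LinearMap.BilinForm ℝ W :=
  LinearMap.mk₂ ℝ (fun f g => B f g)
    (fun f g h => hB.add_left f f.2 g g.2 h h.2)
    (fun c f h => hB.smul_left c f f.2 h h.2)
    (fun f g h => by
      rw [hB.symm f f.2 _ (g + h).2, hB.symm f f.2 g g.2, hB.symm f f.2 h h.2]
      exact hB.add_left g g.2 h h.2 f f.2)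
    (fun c f h => by
      rw [hB.symm f f.2 _ (c • h).2, hB.symm f f.2 h h.2]
      exact hB.smul_left c h h.2 f f.2)

lemma zero_left (hB : IsSymmBilinOn B W) (hf : f ∈ W) : B 0 f = 0 :=
  hB.toBilinForm.map_zero₂ ⟨f, hf⟩

lemma sub_left (hB : IsSymmBilinOn B W) (hf : f ∈ W) (hg : g ∈ W) (hh : h ∈ W) :
    B (f - g) h = B f h - B g h :=
  hB.toBilinForm.map_sub₂ ⟨f, hf⟩ ⟨g, hg⟩ ⟨h, hh⟩

/-- The orthogonal complement of `V` inside `W`. -/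
def orthogonal (hB : IsSymmBilinOn B W) (hV : V ≤ W) : Submodule ℝ (X → ℝ) where
  carrier := {f | f ∈ W ∧ ∀ g ∈ V, B f g = 0}
  zero_mem' := ⟨W.zero_mem, fun _ hg => hB.zero_left (hV hg)⟩
  add_mem' hf hf' := ⟨W.add_mem hf.1 hf'.1, fun g hg => by
    rw [hB.add_left _ hf.1 _ hf'.1 g (hV hg), hf.2 g hg, hf'.2 g hg, add_zero]⟩
  smul_mem' c _ hf := ⟨W.smul_mem c hf.1, fun g hg => by
    rw [hB.smul_left c _ hf.1 g (hV hg), hf.2 g hg, mul_zero]⟩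

lemma exists_proj [FiniteDimensional ℝ V] (hB : IsSymmBilinOn B W) (hV : V ≤ W)
    (hdef : ∀ f ∈ V, B f f = 0 → f = 0) (hf : f ∈ W) :
    ∃ p ∈ V, ∀ q ∈ V, B (f - p) q = 0 := by
  have nondeg : (hB.mono hV).toBilinForm.Nondegenerate :=
    ⟨fun p hp => Subtype.ext (hdef p p.2 (hp p)), fun p hp => Subtype.ext (hdef p p.2 (hp p))⟩
  let p : V := (LinearMap.BilinForm.toDual _ nondeg).symm
    (hB.toBilinForm ⟨f, hf⟩ ∘ₗ Submodule.inclusion hV)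
  have hp (q : V) : B p q = B f q :=
    LinearMap.BilinForm.apply_toDual_symm_apply (hB := nondeg) _ q
  refine ⟨p, p.2, fun q hq => ?_⟩
  rw [hB.sub_left hf (hV p.2) (hV hq), hp ⟨q, hq⟩, sub_self]

lemma exists_proj_inf_orthogonal {U : Submodule ℝ (X → ℝ)} [FiniteDimensional ℝ V]
    (hB : IsSymmBilinOn B W) (hUV : U ≤ V) (hV : V ≤ W) (hdef : ∀ f ∈ V, B f f = 0 → f = 0)
    (hf : f ∈ W) :
    ∃ p ∈ V, (∀ g ∈ U, B p g = 0) ∧ ∀ q ∈ V, (∀ g ∈ U, B q g = 0) → B (f - p) q = 0 := by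
  obtain ⟨p, hp, hfp⟩ := hB.exists_proj (V := V ⊓ hB.orthogonal (hUV.trans hV))
    (inf_le_left.trans hV) (fun f hf => hdef f hf.1) hf
  exact ⟨p, hp.1, hp.2.2, fun q hq hqU => hfp q ⟨hq, hV hq, hqU⟩⟩

end Form

end IsSymmBilinOn

section Projection

variable {X : Type} {B : (X → ℝ) → (X → ℝ) → ℝ} {W V : Submodule ℝ (X → ℝ)} {f p : X → ℝ}

lemma orthProj_spec_of_exists {S : Set (X → ℝ)} (h : ∃ p ∈ S, ∀ q ∈ S, B (f - p) q = 0) :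
    orthProj B S f ∈ S ∧ ∀ q ∈ S, B (f - orthProj B S f) q = 0 := by
  rw [orthProj, dif_pos h]
  exact h.choose_spec

lemma IsSymmBilinOn.orthProj_eq (hB : IsSymmBilinOn B W) (hV : V ≤ W)
    (hdef : ∀ f ∈ V, B f f = 0 → f = 0) (hf : f ∈ W) (hp : p ∈ V)
    (hfp : ∀ q ∈ V, B (f - p) q = 0) : orthProj B V f = p := by
  obtain ⟨hp', hfp'⟩ : orthProj B V f ∈ V ∧ ∀ q ∈ V, B (f - orthProj B V f) q = 0 :=
    orthProj_spec_of_exists ⟨p, hp, hfp⟩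
  have hdiff : p - orthProj B V f ∈ V := V.sub_mem hp hp'
  refine (sub_eq_zero.mp (hdef _ hdiff ?_)).symm
  have hsplit : p - orthProj B V f = (f - orthProj B V f) - (f - p) := by abel
  have hsub {r : X → ℝ} (hr : r ∈ V) : f - r ∈ W := W.sub_mem hf (hV hr)
  nth_rw 1 [hsplit]
  rw [hB.sub_left (hsub hp') (hsub hp) (hV hdiff), hfp' _ hdiff, hfp _ hdiff, sub_zero]

end Projection

/-! ### Solid harmonics and the sphere -/

section Harmonics

variable {d m l N : ℕ} {f g Y Z : E d → ℝ}

/-- The solid harmonics of degree `m`, as a subspace of the functions on `ℝ^d`. -/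
def harmonicSubmodule (d m : ℕ) : Submodule ℝ (E d → ℝ) where
  carrier := solidHarmonics d m
  zero_mem' := ⟨0, MvPolynomial.isHomogeneous_zero _ _ _, by simp [laplacian], by ext; simp⟩
  add_mem' := by
    rintro _ _ ⟨P, hP, hP0, rfl⟩ ⟨Q, hQ, hQ0, rfl⟩
    refine ⟨P + Q, hP.add hQ, ?_, by ext; simp⟩
    rw [laplacian] at *
    simp [Finset.sum_add_distrib, hP0, hQ0]
  smul_mem' := by
    rintro c _ ⟨P, hP, hP0, rfl⟩
    refine ⟨c • P, (MvPolynomial.homogeneousSubmodule _ _ m).smul_mem c hP, ?_,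
      by ext; simp [MvPolynomial.smul_eval]⟩
    rw [laplacian] at *
    simp [← Finset.smul_sum, hP0]

lemma mem_harmonicSubmodule_iff : Y ∈ harmonicSubmodule d m ↔
    ∃ P : MvPolynomial (Fin d) ℝ, P.IsHomogeneous m ∧ laplacian d P = 0 ∧ polyFun d P = Y := by
  simp only [funext_iff, polyFun_apply, eq_comm (b := Y _)]
  simp only [← funext_iff]
  rfl

instance (d m : ℕ) : FiniteDimensional ℝ (harmonicSubmodule d m) := by
  have : Module.Finite ℝ (MvPolynomial.homogeneousSubmodule (Fin d) ℝ m) :=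
    Module.Finite.iff_fg.mpr (MvPolynomial.homogeneousSubmodule_fg (Fin d) ℝ m)
  refine Submodule.finiteDimensional_of_le
    (S₂ := (MvPolynomial.homogeneousSubmodule (Fin d) ℝ m).map (polyFun d).toLinearMap) ?_
  intro Y hY
  obtain ⟨P, hP, -, rfl⟩ := mem_harmonicSubmodule_iff.mp hY
  exact ⟨P, hP, rfl⟩

lemma contDiff_of_mem_harmonicSubmodule (hY : Y ∈ harmonicSubmodule d m) {k : WithTop ℕ∞} :
    ContDiff ℝ k Y := by
  obtain ⟨P, -, -, rfl⟩ := mem_harmonicSubmodule_iff.mp hY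
  exact contDiff_polyFun P

lemma apply_smul_of_mem_harmonicSubmodule (hY : Y ∈ harmonicSubmodule d m) (r : ℝ) (x : E d) :
    Y (r • x) = r ^ m * Y x := by
  obtain ⟨P, hP, -, rfl⟩ := mem_harmonicSubmodule_iff.mp hY
  exact polyFun_smul hP r x

/-- Sums of solid harmonics of degrees less than `N`. -/
def harmonicLT (d N : ℕ) : Submodule ℝ (E d → ℝ) :=
  ⨆ m < N, harmonicSubmodule d m

lemma harmonicSubmodule_le_harmonicLT (hm : m < N) : harmonicSubmodule d m ≤ harmonicLT d N :=
  le_iSup₂_of_le m hm le_rfl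

lemma harmonicLT_mono : Monotone (harmonicLT d) := fun _ _ h =>
  iSup₂_le fun _ hm => harmonicSubmodule_le_harmonicLT (hm.trans_le h)

@[simp]
lemma harmonicLT_zero : harmonicLT d 0 = ⊥ := by simp [harmonicLT]

lemma harmonicLT_succ : harmonicLT d (N + 1) = harmonicLT d N ⊔ harmonicSubmodule d N :=
  Nat.iSup_lt_succ _ N

instance (d N : ℕ) : FiniteDimensional ℝ (harmonicLT d N) := by
  induction N with
  | zero => rw [harmonicLT_zero]; infer_instance
  | succ N _ => rw [harmonicLT_succ]; infer_instance

/-- Functions whose restriction to the unit sphere is continuous. -/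
def sphContinuous (d : ℕ) : Submodule ℝ (E d → ℝ) where
  carrier := {g | ContinuousOn g (Metric.sphere 0 1)}
  zero_mem' := continuousOn_const
  add_mem' hf hg := hf.add hg
  smul_mem' c _ hf := hf.const_smul c

lemma harmonicLT_le_sphContinuous (d N : ℕ) : harmonicLT d N ≤ sphContinuous d :=
  iSup₂_le fun _ _ _ hY => (contDiff_of_mem_harmonicSubmodule (k := 0) hY).continuous.continuousOn

lemma harmonicSubmodule_le_sphContinuous (d m : ℕ) : harmonicSubmodule d m ≤ sphContinuous d :=
  (harmonicSubmodule_le_harmonicLT m.lt_succ_self).trans (harmonicLT_le_sphContinuous d (m + 1))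

instance (d : ℕ) : IsFiniteMeasure (sphMeasure d) := by unfold sphMeasure; infer_instance

instance (d : ℕ) : (sphMeasure d).IsOpenPosMeasure := by unfold sphMeasure; infer_instance

lemma sphArea_pos [NeZero d] : 0 < sphArea d := by
  have : Nonempty (Metric.sphere (0 : E d) 1) :=
    (NormedSpace.sphere_nonempty.mpr zero_le_one).to_subtype
  exact ENNReal.toReal_pos (isOpen_univ.measure_pos _ Set.univ_nonempty).ne' (measure_ne_top _ _)

lemma integrable_sphMeasure (hg : g ∈ sphContinuous d) :
    Integrable (fun ξ : Metric.sphere (0 : E d) 1 => g ξ) (sphMeasure d) :=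
  (continuousOn_iff_continuous_domRestrict.mp hg).integrable_of_hasCompactSupport
    (HasCompactSupport.of_compactSpace _)

lemma sphInner_congr_left (h : Set.EqOn f g (Metric.sphere 0 1)) :
    sphInner d f Y = sphInner d g Y :=
  congrArg (1 / sphArea d * ·) <| integral_congr_ae <| .of_forall fun ξ =>
    congrArg (· * Y ξ) (h ξ.2)

@[simp]
lemma sphInner_zero_left (f : E d → ℝ) : sphInner d 0 f = 0 := by simp [sphInner, sphInt]

@[simp]
lemma sphInner_zero_right (f : E d → ℝ) : sphInner d f 0 = 0 := by simp [sphInner, sphInt]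

lemma isSymmBilinOn_sphInner (d : ℕ) : IsSymmBilinOn (sphInner d) (sphContinuous d) where
  symm f _ g _ := by simp only [sphInner, mul_comm]
  add_left f hf g hg h hh := by
    have := integral_add (integrable_sphMeasure (g := f * h) (ContinuousOn.mul hf hh))
      (integrable_sphMeasure (g := g * h) (ContinuousOn.mul hg hh))
    simpa only [sphInner, sphInt, Pi.add_apply, Pi.mul_apply, add_mul, mul_add] using
      congrArg (1 / sphArea d * ·) this
  smul_left c f _ h _ := by
    simp only [sphInner, sphInt, Pi.smul_apply, smul_eq_mul, mul_assoc c, integral_const_mul]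
    ring

lemma eqOn_zero_of_sphInt_eq_zero (hg : g ∈ sphContinuous d)
    (hg0 : ∀ ξ ∈ Metric.sphere (0 : E d) 1, 0 ≤ g ξ) (h : sphInt d g = 0) :
    Set.EqOn g 0 (Metric.sphere 0 1) := by
  have ae_zero := (integral_eq_zero_iff_of_nonneg (fun ξ => hg0 _ ξ.2)
    (integrable_sphMeasure hg)).mp h
  have zero := (continuousOn_iff_continuous_domRestrict.mp hg).ae_eq_iff_eq (sphMeasure d)
    continuous_const |>.mp ae_zero
  exact fun ξ hξ => congr_fun zero ⟨ξ, hξ⟩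

lemma sphInner_self_nonneg (f : E d → ℝ) : 0 ≤ sphInner d f f :=
  mul_nonneg (one_div_nonneg.mpr measureReal_nonneg) (integral_nonneg fun _ => mul_self_nonneg _)

lemma eqOn_zero_of_sphInner_self [NeZero d] (hf : f ∈ sphContinuous d)
    (h : sphInner d f f = 0) : Set.EqOn f 0 (Metric.sphere 0 1) := by
  have int_sq : sphInt d (fun ξ => f ξ * f ξ) = 0 :=
    (mul_eq_zero.mp h).resolve_left (one_div_ne_zero sphArea_pos.ne')
  exact fun ξ hξ => mul_self_eq_zero.mp <|
    eqOn_zero_of_sphInt_eq_zero (ContinuousOn.mul hf hf) (fun ξ _ => mul_self_nonneg _) int_sq hξ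

lemma sphInner_eq_zero_of_ne [NeZero d] (hml : m ≠ l) (hY : Y ∈ harmonicSubmodule d m)
    (hZ : Z ∈ harmonicSubmodule d l) : sphInner d Y Z = 0 := by
  obtain ⟨P, hP, hP0, rfl⟩ := mem_harmonicSubmodule_iff.mp hY
  obtain ⟨Q, hQ, hQ0, rfl⟩ := mem_harmonicSubmodule_iff.mp hZ
  exact mul_eq_zero_of_right _ (sphInt_polyFun_mul_eq_zero hml hP hP0 hQ hQ0)

lemma sphInner_harmonicLT_eq_zero [NeZero d] (hm : N ≤ m) (hZ : Z ∈ harmonicLT d N)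
    (hY : Y ∈ harmonicSubmodule d m) : sphInner d Z Y = 0 := by
  suffices harmonicLT d N ≤
      (isSymmBilinOn_sphInner d).orthogonal (harmonicSubmodule_le_sphContinuous d m) from
    (this hZ).2 Y hY
  exact iSup₂_le fun l hl Z hZ => ⟨harmonicSubmodule_le_sphContinuous d l hZ, fun Y hY =>
    sphInner_eq_zero_of_ne (hl.trans_le hm).ne hZ hY⟩

lemma exists_eq_norm_smul [NeZero d] (x : E d) :
    ∃ ξ ∈ Metric.sphere (0 : E d) 1, x = ‖x‖ • ξ := by
  rcases eq_or_ne x 0 with rfl | hx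
  · obtain ⟨ξ, hξ⟩ := NormedSpace.sphere_nonempty (x := (0 : E d)) (r := 1) |>.mpr zero_le_one
    exact ⟨ξ, hξ, by simp⟩
  · exact ⟨‖x‖⁻¹ • x, by simp [norm_smul, hx], by simp [smul_smul, hx]⟩

lemma harmonicSubmodule_eq_zero_of_eqOn [NeZero d] (hY : Y ∈ harmonicSubmodule d m)
    (h : Set.EqOn Y 0 (Metric.sphere 0 1)) : Y = 0 := by
  ext x
  obtain ⟨ξ, hξ, hx⟩ := exists_eq_norm_smul x
  rw [hx, apply_smul_of_mem_harmonicSubmodule hY, h hξ]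
  simp

lemma harmonicLT_eq_zero_of_eqOn [NeZero d] (hZ : Z ∈ harmonicLT d N)
    (h : Set.EqOn Z 0 (Metric.sphere 0 1)) : Z = 0 := by
  induction N generalizing Z with
  | zero => simpa using hZ
  | succ N ih =>
    rw [harmonicLT_succ] at hZ
    obtain ⟨Z', hZ', Y, hY, rfl⟩ := Submodule.mem_sup.mp hZ
    have hYc := harmonicSubmodule_le_sphContinuous d N hY
    have top_inner : sphInner d Y Y = 0 := by
      calc sphInner d Y Y = sphInner d Z' Y + sphInner d Y Y := by
            rw [sphInner_harmonicLT_eq_zero le_rfl hZ' hY, zero_add]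
        _ = sphInner d (Z' + Y) Y := ((isSymmBilinOn_sphInner d).add_left _
            (harmonicLT_le_sphContinuous d N hZ') _ hYc _ hYc).symm
        _ = sphInner d 0 Y := sphInner_congr_left h
        _ = 0 := sphInner_zero_left Y
    obtain rfl : Y = 0 :=
      harmonicSubmodule_eq_zero_of_eqOn hY (eqOn_zero_of_sphInner_self hYc top_inner)
    rw [add_zero] at h ⊢
    exact ih hZ' h

lemma harmonicLT_definite [NeZero d] (hZ : Z ∈ harmonicLT d N) (h : sphInner d Z Z = 0) : Z = 0 :=
  harmonicLT_eq_zero_of_eqOn hZ (eqOn_zero_of_sphInner_self (harmonicLT_le_sphContinuous d N hZ) h)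

lemma harmonicSubmodule_definite [NeZero d] (hY : Y ∈ harmonicSubmodule d m)
    (h : sphInner d Y Y = 0) : Y = 0 :=
  harmonicLT_definite (harmonicSubmodule_le_harmonicLT m.lt_succ_self hY) h

lemma mem_harmonicSubmodule_of_orthogonal [NeZero d] (hZ : Z ∈ harmonicLT d (N + 1))
    (h : ∀ Y ∈ harmonicLT d N, sphInner d Z Y = 0) : Z ∈ harmonicSubmodule d N := by
  rw [harmonicLT_succ] at hZ
  obtain ⟨Z', hZ', Y, hY, rfl⟩ := Submodule.mem_sup.mp hZ
  have hZc := harmonicLT_le_sphContinuous d N hZ'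
  have hYc := harmonicSubmodule_le_sphContinuous d N hY
  have low_inner : sphInner d Z' Z' = 0 := by
    rw [← h Z' hZ', (isSymmBilinOn_sphInner d).add_left _ hZc _ hYc _ hZc,
      (isSymmBilinOn_sphInner d).symm Y hYc Z' hZc, sphInner_harmonicLT_eq_zero le_rfl hZ' hY,
      add_zero]
  rwa [harmonicLT_definite hZ' low_inner, zero_add]

lemma sphProj_eq [NeZero d] (hg : g ∈ sphContinuous d) (hY : Y ∈ harmonicSubmodule d m)
    (h : ∀ Z ∈ harmonicSubmodule d m, sphInner d (g - Y) Z = 0) : sphProj d m g = Y :=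
  (isSymmBilinOn_sphInner d).orthProj_eq (harmonicSubmodule_le_sphContinuous d m)
    (fun _ => harmonicSubmodule_definite) hg hY h

end Harmonics

/-! ### Derivatives in the last variable -/

section Tderiv

variable {d k n s : ℕ} {f g : E d × ℝ → ℝ} {p : E d × ℝ}

@[simp]
lemma tderiv_zero (f : E d × ℝ → ℝ) : tderiv 0 f = f := by
  ext p; simp [tderiv]

lemma tderiv_one_apply (f : E d × ℝ → ℝ) (p : E d × ℝ) :
    tderiv 1 f p = deriv (fun τ => f (p.1, τ)) p.2 := by
  simp [tderiv, iteratedDeriv_one]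

lemma tderiv_succ (k : ℕ) (f : E d × ℝ → ℝ) : tderiv (k + 1) f = tderiv 1 (tderiv k f) := by
  ext p
  rw [tderiv_one_apply, tderiv, iteratedDeriv_succ]
  rfl

lemma contDiffAt_comp_prodMk {k : WithTop ℕ∞} (hf : ContDiffAt ℝ k f p) :
    ContDiffAt ℝ k (fun τ => f (p.1, τ)) p.2 :=
  ContDiffAt.comp (x := p.2) (f := fun τ : ℝ => (p.1, τ)) (g := f) hf
    (contDiffAt_const.prodMk contDiffAt_id)

lemma tderiv_add (hf : ContDiffAt ℝ k f p) (hg : ContDiffAt ℝ k g p) :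
    tderiv k (f + g) p = tderiv k f p + tderiv k g p :=
  iteratedDeriv_add (contDiffAt_comp_prodMk hf) (contDiffAt_comp_prodMk hg)

lemma tderiv_sub (hf : ContDiffAt ℝ k f p) (hg : ContDiffAt ℝ k g p) :
    tderiv k (f - g) p = tderiv k f p - tderiv k g p :=
  iteratedDeriv_sub (contDiffAt_comp_prodMk hf) (contDiffAt_comp_prodMk hg)

lemma tderiv_smul (k : ℕ) (c : ℝ) (f : E d × ℝ → ℝ) : tderiv k (c • f) = c • tderiv k f :=
  funext fun _ => iteratedDeriv_const_mul_field c _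

@[simp]
lemma tderiv_zero_fun (k : ℕ) : tderiv k (0 : E d × ℝ → ℝ) = 0 := by
  simpa using tderiv_smul k 0 (0 : E d × ℝ → ℝ)

lemma contDiff_sum_smul {ι : Type*} (S : Finset ι) (c : ι → ℝ) {F : ι → E d × ℝ → ℝ}
    (hF : ∀ i ∈ S, ContDiff ℝ k (F i)) : ContDiff ℝ k (∑ i ∈ S, c i • F i) := by
  rw [Finset.sum_fn]
  exact ContDiff.sum fun i hi => (hF i hi).const_smul (c i)

lemma tderiv_sum_smul {ι : Type*} (S : Finset ι) (c : ι → ℝ) {F : ι → E d × ℝ → ℝ}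
    (hF : ∀ i ∈ S, ContDiff ℝ k (F i)) :
    tderiv k (∑ i ∈ S, c i • F i) = ∑ i ∈ S, c i • tderiv k (F i) := by
  classical
  induction S using Finset.induction_on with
  | empty => simp
  | insert i S hi ih =>
    rw [Finset.forall_mem_insert] at hF
    rw [Finset.sum_insert hi, Finset.sum_insert hi, ← ih hF.2, ← tderiv_smul]
    exact funext fun p => tderiv_add (hF.1.const_smul (c i)).contDiffAt
      (contDiff_sum_smul S c hF.2).contDiffAt

lemma contDiffAt_tderiv_one {j : ℕ} (hf : ContDiffAt ℝ (j + 1 : ℕ) f p) :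
    ContDiffAt ℝ j (tderiv 1 f) p := by
  have hfderiv : ContDiffAt ℝ j (fun q => fderiv ℝ f q (0, 1)) p :=
    (hf.fderiv_right (m := j) (by norm_cast)).clm_apply contDiffAt_const
  refine hfderiv.congr_of_eventuallyEq ?_
  filter_upwards [hf.eventually (by simp)] with q hq
  have hline : HasDerivAt (fun τ : ℝ => (q.1, τ)) ((0 : E d), (1 : ℝ)) q.2 :=
    (hasDerivAt_const _ _).prodMk (hasDerivAt_id _)
  rw [tderiv_one_apply]
  exact ((hq.differentiableAt (by simp)).hasFDerivAt.comp_hasDerivAt q.2 hline).deriv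

lemma contDiffAt_tderiv {j : ℕ} (hf : ContDiffAt ℝ (j + k : ℕ) f p) :
    ContDiffAt ℝ j (tderiv k f) p := by
  induction k generalizing j with
  | zero => simpa using hf
  | succ k ih =>
    rw [tderiv_succ]
    exact contDiffAt_tderiv_one (ih (by rwa [add_assoc, add_comm 1]))

lemma continuousAt_tderiv (hk : k ≤ s) (hf : ContDiffAt ℝ s f p) : ContinuousAt (tderiv k f) p :=
  (contDiffAt_tderiv (j := 0) (hf.of_le (by simpa using hk))).continuousAt

theorem taylor_eq_sum_add_integral_tderiv (hs : 1 ≤ s) {x : E d} {t : ℝ}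
    (hf : ∀ v ∈ Set.uIcc 1 t, ContDiffAt ℝ s f (x, v)) :
    f (x, t) = ∑ m ∈ Finset.range s, (t - 1) ^ m / (m.factorial : ℝ) * tderiv m f (x, 1) +
      (-1 : ℝ) ^ s * ∫ v in t..1, (v - t) ^ (s - 1) / ((s - 1).factorial : ℝ) *
        tderiv s f (x, v) := by
  obtain ⟨n, rfl⟩ : ∃ n, s = n + 1 := ⟨s - 1, by omega⟩
  rcases eq_or_ne 1 t with rfl | ht
  · simp [Finset.sum_range_succ']
  have hslice : ∀ v ∈ Set.uIcc 1 t, ContDiffAt ℝ (n + 1 : ℕ) (fun τ => f (x, τ)) v :=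
    fun v hv => contDiffAt_comp_prodMk (hf v hv)
  have iteratedDerivWithin_eq : ∀ m ≤ n + 1, ∀ v ∈ Set.uIcc 1 t,
      iteratedDerivWithin m (fun τ => f (x, τ)) (Set.uIcc 1 t) v = tderiv m f (x, v) :=
    fun m hm v hv => iteratedDerivWithin_eq_iteratedDeriv (uniqueDiffOn_uIcc ht)
      ((hslice v hv).of_le (by exact_mod_cast hm)) hv
  have taylor := taylor_integral_remainder (f := fun τ => f (x, τ)) (x := t) (x₀ := 1) (n := n)
    (fun v hv => (hslice v hv).contDiffWithinAt)
  rw [taylor_within_apply, sub_eq_iff_eq_add'] at taylor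
  rw [taylor, Nat.add_sub_cancel]
  congr 1
  · refine Finset.sum_congr rfl fun m hm => ?_
    rw [iteratedDerivWithin_eq m (Finset.mem_range.mp hm).le 1 Set.left_mem_uIcc, smul_eq_mul]
    ring
  · rw [intervalIntegral.integral_symm, ← intervalIntegral.integral_const_mul,
      ← intervalIntegral.integral_neg]
    refine intervalIntegral.integral_congr fun v hv => ?_
    rw [iteratedDerivWithin_eq (n + 1) le_rfl v (by rwa [Set.uIcc_comm]), smul_eq_mul,
      ← neg_sub v t, neg_pow, pow_succ (-1 : ℝ) n]
    ring

end Tderiv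

/-! ### Polynomials on the cone -/

section ConePoly

variable {d k m j N : ℕ} {f g : E d × ℝ → ℝ} {Y Z : E d → ℝ}

/-- The function `t ^ j * Y x` on `E d × ℝ`, linear in `Y`. For a solid harmonic `Y` these are the
products that span `conePoly`. -/
def coneMonomial (d j : ℕ) : (E d → ℝ) →ₗ[ℝ] (E d × ℝ → ℝ) where
  toFun Y p := p.2 ^ j * Y p.1
  map_add' Y Z := by ext; simp [mul_add]
  map_smul' c Y := by ext; simp [mul_left_comm]

@[simp]
lemma coneMonomial_apply (Y : E d → ℝ) (p : E d × ℝ) :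
    coneMonomial d j Y p = p.2 ^ j * Y p.1 := rfl

/-- The section of `f` at height `t`, rescaled so that the unit sphere parametrizes the part of the
cone at that height. At `t = 1` this is the trace of `f` on the base. -/
def coneSlice (d : ℕ) (t : ℝ) : (E d × ℝ → ℝ) →ₗ[ℝ] (E d → ℝ) :=
  LinearMap.funLeft ℝ ℝ fun x => (t • x, t)

@[simp]
lemma coneSlice_apply (t : ℝ) (f : E d × ℝ → ℝ) (x : E d) : coneSlice d t f x = f (t • x, t) := rfl

lemma coneMonomial_mem_conePoly (h : j + m < N) (hY : Y ∈ harmonicSubmodule d m) :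
    coneMonomial d j Y ∈ conePoly d N :=
  Submodule.subset_span ⟨j, m, Y, h, hY, rfl⟩

lemma conePoly_le {V : Submodule ℝ (E d × ℝ → ℝ)}
    (h : ∀ j m, j + m < N → ∀ Y ∈ harmonicSubmodule d m, coneMonomial d j Y ∈ V) :
    conePoly d N ≤ V := by
  refine Submodule.span_le.mpr ?_
  rintro _ ⟨j, m, Y, hjm, hY, rfl⟩
  exact h j m hjm Y hY

@[elab_as_elim]
lemma conePoly_induction {P : ∀ g, g ∈ conePoly d N → Prop}
    (monomial : ∀ (j m : ℕ) (h : j + m < N) (Y : E d → ℝ) (hY : Y ∈ harmonicSubmodule d m),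
      P (coneMonomial d j Y) (coneMonomial_mem_conePoly h hY))
    (zero : P 0 (Submodule.zero_mem _))
    (add : ∀ f g hf hg, P f hf → P g hg → P (f + g) (Submodule.add_mem _ hf hg))
    (smul : ∀ (c : ℝ) f hf, P f hf → P (c • f) (Submodule.smul_mem _ c hf))
    (hg : g ∈ conePoly d N) : P g hg := by
  refine Submodule.span_induction (p := P) ?_ zero add smul hg
  rintro _ ⟨j, m, Y, hjm, hY, rfl⟩
  exact monomial j m hjm Y hY

lemma conePoly_mono : Monotone (conePoly d) := fun _ _ h =>
  conePoly_le fun _ _ hjm _ hY => coneMonomial_mem_conePoly (hjm.trans_le h) hY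

@[simp]
lemma conePoly_zero : conePoly d 0 = ⊥ :=
  le_bot_iff.mp <| conePoly_le fun _ _ h => absurd h (Nat.not_lt_zero _)

instance (d N : ℕ) : FiniteDimensional ℝ (conePoly d N) := by
  refine Submodule.finiteDimensional_of_le
    (S₂ := ⨆ i : Fin N × Fin N, (harmonicSubmodule d i.2).map (coneMonomial d i.1)) ?_
  refine conePoly_le fun j m h Y hY => ?_
  exact Submodule.mem_iSup_of_mem (⟨j, by omega⟩, ⟨m, by omega⟩) ⟨Y, hY, rfl⟩

lemma contDiff_of_mem_conePoly (hg : g ∈ conePoly d N) {k : WithTop ℕ∞} : ContDiff ℝ k g := by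
  induction hg using conePoly_induction with
  | monomial j m _ Y hY =>
    exact (contDiff_snd.pow j).mul ((contDiff_of_mem_harmonicSubmodule hY).comp contDiff_fst)
  | zero => exact contDiff_const
  | add f g _ _ hf hg => exact hf.add hg
  | smul c f _ hf => exact hf.const_smul c

lemma coneSlice_mem_harmonicLT (hg : g ∈ conePoly d N) (t : ℝ) :
    coneSlice d t g ∈ harmonicLT d N := by
  suffices conePoly d N ≤ (harmonicLT d N).comap (coneSlice d t) from this hg
  refine conePoly_le fun j m h Y hY => ?_
  have slice_eq : coneSlice d t (coneMonomial d j Y) = (t ^ j * t ^ m) • Y := by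
    ext x
    simp [apply_smul_of_mem_harmonicSubmodule hY, mul_assoc]
  rw [Submodule.mem_comap, slice_eq]
  exact Submodule.smul_mem _ _ (harmonicSubmodule_le_harmonicLT (by omega) hY)

lemma coneMonomial_zero_mem_conePoly (hZ : Z ∈ harmonicLT d N) :
    coneMonomial d 0 Z ∈ conePoly d N := by
  suffices harmonicLT d N ≤ (conePoly d N).comap (coneMonomial d 0) from this hZ
  exact iSup₂_le fun m hm Y hY => coneMonomial_mem_conePoly (by omega) hY

lemma conePoly_eq_zero [NeZero d] (hg : g ∈ conePoly d N)
    (h : ∀ t ∈ Set.Ioo (0 : ℝ) 1, Set.EqOn (coneSlice d t g) 0 (Metric.sphere 0 1)) : g = 0 := by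
  have eq_zero_of_mem_Ioo : ∀ t ∈ Set.Ioo (0 : ℝ) 1, ∀ x, g (x, t) = 0 := by
    intro t ht x
    have slice_zero := harmonicLT_eq_zero_of_eqOn (coneSlice_mem_harmonicLT hg t) (h t ht)
    simpa [smul_smul, ht.1.ne'] using congrFun slice_zero (t⁻¹ • x)
  ext ⟨x, t⟩
  have analytic : AnalyticOnNhd ℝ (fun τ => g (x, τ)) Set.univ :=
    contDiff_omega_iff_analyticOnNhd.mp
      ((contDiff_of_mem_conePoly hg).comp (contDiff_prodMk_right x))
  have near : (fun τ => g (x, τ)) =ᶠ[nhds (1 / 2)] 0 := by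
    filter_upwards [Ioo_mem_nhds (a := (0 : ℝ)) (b := 1) (by norm_num) (by norm_num)] with τ hτ
    exact eq_zero_of_mem_Ioo τ hτ x
  exact congrFun (analytic.eq_of_eventuallyEq (fun _ _ => analyticAt_const) near) t

lemma tderiv_one_coneMonomial (j : ℕ) (Y : E d → ℝ) :
    tderiv 1 (coneMonomial d j Y) = (j : ℝ) • coneMonomial d (j - 1) Y := by
  ext p
  simp [tderiv_one_apply, mul_assoc]

lemma tderiv_add_of_mem_conePoly {M : ℕ} (k : ℕ) (hf : f ∈ conePoly d M) (hg : g ∈ conePoly d N) :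
    tderiv k (f + g) = tderiv k f + tderiv k g :=
  funext fun _ => tderiv_add (contDiff_of_mem_conePoly hf).contDiffAt
    (contDiff_of_mem_conePoly hg).contDiffAt

lemma tderiv_one_mem_conePoly (hg : g ∈ conePoly d N) : tderiv 1 g ∈ conePoly d (N - 1) := by
  induction hg using conePoly_induction with
  | monomial j m h Y hY =>
    rw [tderiv_one_coneMonomial]
    rcases j.eq_zero_or_pos with rfl | hj
    · simp
    · exact Submodule.smul_mem _ _ (coneMonomial_mem_conePoly (by omega) hY)
  | zero => simp
  | add f g hf hg ihf ihg =>
    rw [tderiv_add_of_mem_conePoly 1 hf hg]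
    exact Submodule.add_mem _ ihf ihg
  | smul c f _ ih =>
    rw [tderiv_smul]
    exact Submodule.smul_mem _ c ih

lemma tderiv_mem_conePoly (k : ℕ) (hg : g ∈ conePoly d N) : tderiv k g ∈ conePoly d (N - k) := by
  induction k with
  | zero => simpa using hg
  | succ k ih =>
    rw [tderiv_succ, ← Nat.sub_sub]
    exact tderiv_one_mem_conePoly ih

lemma tderiv_eq_zero_of_mem_conePoly (hg : g ∈ conePoly d N) (hN : N ≤ k) : tderiv k g = 0 := by
  simpa [Nat.sub_eq_zero_of_le hN] using tderiv_mem_conePoly k hg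

/-- The trace of `∂_t ^ m f` on the base `t = 1` of the cone. -/
def baseTrace (d m : ℕ) (f : E d × ℝ → ℝ) : E d → ℝ := coneSlice d 1 (tderiv m f)

lemma baseTrace_apply (f : E d × ℝ → ℝ) (x : E d) : baseTrace d m f x = tderiv m f (x, 1) := by
  simp [baseTrace]

lemma baseTrace_mem_harmonicLT (m : ℕ) (hg : g ∈ conePoly d N) :
    baseTrace d m g ∈ harmonicLT d (N - m) :=
  coneSlice_mem_harmonicLT (tderiv_mem_conePoly m hg) 1

lemma exists_tderiv_one_eq (hg : g ∈ conePoly d N) :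
    ∃ G ∈ conePoly d (N + 1), tderiv 1 G = g := by
  induction hg using conePoly_induction with
  | monomial j m h Y hY =>
    refine ⟨((j : ℝ) + 1)⁻¹ • coneMonomial d (j + 1) Y,
      Submodule.smul_mem _ _ (coneMonomial_mem_conePoly (by omega) hY), ?_⟩
    rw [tderiv_smul, tderiv_one_coneMonomial, Nat.cast_add_one, Nat.add_sub_cancel,
      inv_smul_smul₀ (by positivity)]
  | zero => exact ⟨0, Submodule.zero_mem _, tderiv_zero_fun 1⟩
  | add f g _ _ ihf ihg =>
    obtain ⟨⟨F, hF, rfl⟩, G, hG, rfl⟩ := And.intro ihf ihg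
    exact ⟨F + G, Submodule.add_mem _ hF hG, tderiv_add_of_mem_conePoly 1 hF hG⟩
  | smul c f _ ih =>
    obtain ⟨F, hF, rfl⟩ := ih
    exact ⟨c • F, Submodule.smul_mem _ c hF, tderiv_smul 1 c F⟩

lemma exists_tderiv_one_eq_coneSlice_eq (hg : g ∈ conePoly d (N - 1)) (hZ : Z ∈ harmonicLT d N) :
    ∃ G ∈ conePoly d N, tderiv 1 G = g ∧ coneSlice d 1 G = Z := by
  rcases N with _ | N
  · obtain ⟨rfl, rfl⟩ : g = 0 ∧ Z = 0 := ⟨by simpa using hg, by simpa using hZ⟩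
    exact ⟨0, Submodule.zero_mem _, tderiv_zero_fun 1, map_zero _⟩
  obtain ⟨F, hF, hFg⟩ := exists_tderiv_one_eq hg
  rw [Nat.add_sub_cancel] at hF
  have hW := coneMonomial_zero_mem_conePoly (Submodule.sub_mem _ hZ (coneSlice_mem_harmonicLT hF 1))
  refine ⟨_, Submodule.add_mem _ hF hW, ?_, by ext x; simp⟩
  rw [tderiv_add_of_mem_conePoly 1 hF hW, tderiv_one_coneMonomial, hFg]
  simp

theorem exists_tderiv_eq_baseTrace_eq {s : ℕ} (hg : g ∈ conePoly d (N - s)) {Z : ℕ → E d → ℝ}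
    (hZ : ∀ m < s, Z m ∈ harmonicLT d (N - m)) :
    ∃ G ∈ conePoly d N, tderiv s G = g ∧ ∀ m < s, baseTrace d m G = Z m := by
  induction s generalizing g with
  | zero => exact ⟨g, hg, tderiv_zero g, by simp⟩
  | succ s ih =>
    obtain ⟨F, hF, hFg, hFZ⟩ := exists_tderiv_one_eq_coneSlice_eq hg (hZ s s.lt_succ_self)
    obtain ⟨G, hG, hGF, hGZ⟩ := ih hF fun m hm => hZ m (by omega)
    refine ⟨G, hG, by rw [tderiv_succ, hGF, hFg], fun m hm => ?_⟩
    rcases Nat.lt_succ_iff_lt_or_eq.mp hm with hm | rfl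
    · exact hGZ m hm
    · rw [baseTrace, hGF, hFZ]

end ConePoly

/-! ### The weighted inner product on the conic surface -/

section ConeInner

variable {d n N : ℕ} {β γ t : ℝ} {f g p : E d × ℝ → ℝ}

/-- Functions on `E d × ℝ` whose restriction to the conic surface is continuous. -/
def coneContinuous (d : ℕ) : Submodule ℝ (E d × ℝ → ℝ) where
  carrier := {g | ContinuousOn g (cone d)}
  zero_mem' := continuousOn_const
  add_mem' hf hg := hf.add hg
  smul_mem' c _ hf := hf.const_smul c

lemma conePoly_le_coneContinuous (d N : ℕ) : conePoly d N ≤ coneContinuous d :=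
  fun _ hg => (contDiff_of_mem_conePoly (k := 0) hg).continuous.continuousOn

lemma smul_mem_cone (ht : t ∈ Set.Icc 0 1) {ξ : E d} (hξ : ξ ∈ Metric.sphere (0 : E d) 1) :
    (t • ξ, t) ∈ cone d := by
  rw [mem_sphere_zero_iff_norm] at hξ
  exact ⟨by simp [norm_smul, hξ, abs_of_nonneg ht.1], ht⟩

lemma coneSlice_mem_sphContinuous (hg : g ∈ coneContinuous d) (ht : t ∈ Set.Icc 0 1) :
    coneSlice d t g ∈ sphContinuous d :=
  ContinuousOn.comp (g := g) (f := fun ξ => (t • ξ, t)) hg (by fun_prop)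
    fun _ hξ => smul_mem_cone ht hξ

lemma continuousOn_sphInner_coneSlice (hf : f ∈ coneContinuous d) (hg : g ∈ coneContinuous d) :
    ContinuousOn (fun t => sphInner d (coneSlice d t f) (coneSlice d t g)) (Set.Icc 0 1) := by
  rw [continuousOn_iff_continuous_domRestrict]
  have integrand : Continuous (Function.uncurry fun (t : Set.Icc (0 : ℝ) 1)
      (ξ : Metric.sphere (0 : E d) 1) => (f * g) ((t : ℝ) • (ξ : E d), (t : ℝ))) :=
    (ContinuousOn.mul hf hg).comp_continuous
      (f := fun q : Set.Icc (0 : ℝ) 1 × Metric.sphere (0 : E d) 1 =>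
        ((q.1 : ℝ) • (q.2 : E d), (q.1 : ℝ)))
      (by fun_prop) fun q => smul_mem_cone q.1.2 q.2.2
  have integral := continuous_parametric_integral_of_continuous (μ := sphMeasure d) integrand
    isCompact_univ
  rw [Measure.restrict_univ] at integral
  exact continuous_const.mul integral

/-- The Jacobi weight together with the factor `t ^ (d - 1)` of the surface measure. -/
def coneWeight (d : ℕ) (β γ t : ℝ) : ℝ := t ^ (d - 1) * (t ^ β * (1 - t) ^ γ)

lemma coneWeight_pos (ht : t ∈ Set.Ioo 0 1) : 0 < coneWeight d β γ t :=
  mul_pos (pow_pos ht.1 _) <|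
    mul_pos (Real.rpow_pos_of_pos ht.1 _) (Real.rpow_pos_of_pos (sub_pos.mpr ht.2) _)

lemma coneWeight_nonneg (ht : t ∈ Set.Icc 0 1) : 0 ≤ coneWeight d β γ t :=
  mul_nonneg (pow_nonneg ht.1 _) <|
    mul_nonneg (Real.rpow_nonneg ht.1 _) (Real.rpow_nonneg (sub_nonneg.mpr ht.2) _)

lemma intervalIntegrable_coneWeight [NeZero d] (hβ : -(d : ℝ) < β) (hγ : -1 < γ) :
    IntervalIntegrable (coneWeight d β γ) volume 0 1 := by
  have hu : 0 < ((β + d : ℝ) : ℂ).re := by rw [Complex.ofReal_re]; linarith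
  have hv : 0 < ((γ + 1 : ℝ) : ℂ).re := by rw [Complex.ofReal_re]; linarith
  refine (Complex.betaIntegral_convergent hu hv).norm.congr fun t ht => ?_
  rw [Set.uIoc_of_le zero_le_one] at ht
  have hd : ((d - 1 : ℕ) : ℝ) = d - 1 := Nat.cast_pred (NeZero.pos d)
  have norm_cpow {r : ℝ} (hr : 0 ≤ r) (a : ℝ) : ‖(r : ℂ) ^ (a : ℂ)‖ = r ^ a := by
    rw [← Complex.ofReal_cpow hr, Complex.norm_of_nonneg (Real.rpow_nonneg hr a)]
  have hleft := norm_cpow ht.1.le (β + d - 1)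
  have hright := norm_cpow (sub_nonneg.mpr ht.2) γ
  push_cast at hleft hright ⊢
  rw [norm_mul, hleft, add_sub_cancel_right, hright, coneWeight, ← mul_assoc, ← Real.rpow_natCast,
    ← Real.rpow_add ht.1, hd]
  ring_nf

lemma coneInner_eq_integral [NeZero d] (β γ : ℝ) (f g : E d × ℝ → ℝ) :
    coneInner d β γ f g = coneConst d β γ * sphArea d *
      ∫ t in (0 : ℝ)..1, coneWeight d β γ t * sphInner d (coneSlice d t f) (coneSlice d t g) := by
  rw [coneInner, coneInt, mul_assoc, ← intervalIntegral.integral_const_mul (sphArea d)]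
  have hA := (sphArea_pos (d := d)).ne'
  congr 1
  refine intervalIntegral.integral_congr fun t _ => ?_
  simp only [sphInner, sphInt, coneSlice_apply, coneWeight, integral_mul_const]
  field_simp

@[simp]
lemma coneInner_zero_left (f : E d × ℝ → ℝ) : coneInner d β γ 0 f = 0 := by
  simp [coneInner, coneInt, sphInt]

@[simp]
lemma coneInner_zero_right (f : E d × ℝ → ℝ) : coneInner d β γ f 0 = 0 := by
  simp [coneInner, coneInt, sphInt]

lemma coneConst_pos [NeZero d] (hβ : -(d : ℝ) < β) (hγ : -1 < γ) : 0 < coneConst d β γ := by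
  have := sphArea_pos (d := d)
  have := Real.Gamma_pos_of_pos (s := β + d + γ + 1) (by linarith)
  have := Real.Gamma_pos_of_pos (s := β + d) (by linarith)
  have := Real.Gamma_pos_of_pos (s := γ + 1) (by linarith)
  unfold coneConst
  positivity

lemma intervalIntegrable_coneWeight_mul_sphInner [NeZero d] (hβ : -(d : ℝ) < β) (hγ : -1 < γ)
    (hf : f ∈ coneContinuous d) (hg : g ∈ coneContinuous d) :
    IntervalIntegrable
      (fun t => coneWeight d β γ t * sphInner d (coneSlice d t f) (coneSlice d t g))
      volume 0 1 :=
  (intervalIntegrable_coneWeight hβ hγ).mul_continuousOn <| by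
    rw [Set.uIcc_of_le zero_le_one]
    exact continuousOn_sphInner_coneSlice hf hg

lemma coneInner_congr_left [NeZero d] (h : Set.EqOn f g (cone d)) :
    coneInner d β γ f p = coneInner d β γ g p := by
  simp only [coneInner_eq_integral]
  congr 1
  refine intervalIntegral.integral_congr fun t ht => ?_
  rw [Set.uIcc_of_le zero_le_one] at ht
  exact congrArg (coneWeight d β γ t * ·) <|
    sphInner_congr_left fun ξ hξ => h (smul_mem_cone ht hξ)

lemma isSymmBilinOn_coneInner [NeZero d] (hβ : -(d : ℝ) < β) (hγ : -1 < γ) :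
    IsSymmBilinOn (coneInner d β γ) (coneContinuous d) where
  symm f _ g _ := by simp only [coneInner, mul_comm (f _)]
  add_left f hf g hg h hh := by
    simp only [coneInner_eq_integral]
    rw [← mul_add, ← intervalIntegral.integral_add
      (intervalIntegrable_coneWeight_mul_sphInner hβ hγ hf hh)
      (intervalIntegrable_coneWeight_mul_sphInner hβ hγ hg hh)]
    congr 1
    refine intervalIntegral.integral_congr fun t ht => ?_
    rw [Set.uIcc_of_le zero_le_one] at ht
    have slice_mem {r} (hr : r ∈ coneContinuous d) := coneSlice_mem_sphContinuous hr ht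
    simp only [map_add]
    rw [(isSymmBilinOn_sphInner d).add_left _ (slice_mem hf) _ (slice_mem hg) _ (slice_mem hh),
      mul_add]
  smul_left c f hf h hh := by
    simp only [coneInner_eq_integral]
    rw [mul_left_comm, ← intervalIntegral.integral_const_mul c]
    congr 1
    refine intervalIntegral.integral_congr fun t ht => ?_
    rw [Set.uIcc_of_le zero_le_one] at ht
    rw [LinearMap.map_smul, (isSymmBilinOn_sphInner d).smul_left c _
      (coneSlice_mem_sphContinuous hf ht) _ (coneSlice_mem_sphContinuous hh ht), mul_left_comm]

lemma eqOn_zero_of_coneInner_self [NeZero d] (hβ : -(d : ℝ) < β) (hγ : -1 < γ)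
    (hf : f ∈ coneContinuous d) (h : coneInner d β γ f f = 0) (ht : t ∈ Set.Ioo 0 1) :
    Set.EqOn (coneSlice d t f) 0 (Metric.sphere 0 1) := by
  rw [coneInner_eq_integral] at h
  have integral_zero := (mul_eq_zero.mp h).resolve_left
    (mul_pos (coneConst_pos hβ hγ) sphArea_pos).ne'
  have integrand_nonneg : ∀ᵐ t ∂volume.restrict (Set.Ioc (0 : ℝ) 1),
      0 ≤ coneWeight d β γ t * sphInner d (coneSlice d t f) (coneSlice d t f) := by
    filter_upwards [ae_restrict_mem measurableSet_Ioc] with t ht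
    exact mul_nonneg (coneWeight_nonneg (Set.Ioc_subset_Icc_self ht)) (sphInner_self_nonneg _)
  rw [intervalIntegral.integral_eq_zero_iff_of_le_of_nonneg_ae zero_le_one integrand_nonneg
    (intervalIntegrable_coneWeight_mul_sphInner hβ hγ hf hf)] at integral_zero
  have ae_zero : (fun t => sphInner d (coneSlice d t f) (coneSlice d t f))
      =ᵐ[volume.restrict (Set.Ioo 0 1)] 0 := by
    filter_upwards [ae_restrict_of_ae_restrict_of_subset Set.Ioo_subset_Ioc_self integral_zero,
      ae_restrict_mem measurableSet_Ioo] with t ht0 ht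
    exact (mul_eq_zero.mp ht0).resolve_left (coneWeight_pos ht).ne'
  have zero := Measure.eqOn_open_of_ae_eq ae_zero isOpen_Ioo
    ((continuousOn_sphInner_coneSlice hf hf).mono Set.Ioo_subset_Icc_self) continuousOn_const
  exact eqOn_zero_of_sphInner_self
    (coneSlice_mem_sphContinuous hf (Set.Ioo_subset_Icc_self ht)) (zero ht)

lemma conePoly_definite [NeZero d] (hβ : -(d : ℝ) < β) (hγ : -1 < γ) (hg : g ∈ conePoly d N)
    (h : coneInner d β γ g g = 0) : g = 0 :=
  conePoly_eq_zero hg fun _ ht =>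
    eqOn_zero_of_coneInner_self hβ hγ (conePoly_le_coneContinuous d N hg) h ht

lemma IsSymmBilinOn.coe_inf_orthogonal_eq_orthPoly {B : (E d × ℝ → ℝ) → (E d × ℝ → ℝ) → ℝ}
    {W : Submodule ℝ (E d × ℝ → ℝ)} (hB : IsSymmBilinOn B W) (hW : conePoly d (n + 1) ≤ W) :
    ((conePoly d (n + 1) ⊓ hB.orthogonal ((conePoly_mono n.le_succ).trans hW) :
      Submodule ℝ (E d × ℝ → ℝ)) : Set (E d × ℝ → ℝ)) = orthPoly d B n :=
  Set.ext fun _ => ⟨fun h => ⟨h.1, h.2.2⟩, fun h => ⟨h.1, hW h.1, h.2⟩⟩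

lemma coneProj_eq [NeZero d] (hβ : -(d : ℝ) < β) (hγ : -1 < γ) (hf : f ∈ coneContinuous d)
    (hp : p ∈ orthPoly d (coneInner d β γ) n)
    (hfp : ∀ q ∈ orthPoly d (coneInner d β γ) n, coneInner d β γ (f - p) q = 0) :
    coneProj d β γ n f = p := by
  have hB := isSymmBilinOn_coneInner (d := d) hβ hγ
  have hW := conePoly_le_coneContinuous d (n + 1)
  rw [← hB.coe_inf_orthogonal_eq_orthPoly hW] at hp hfp
  rw [coneProj, ← hB.coe_inf_orthogonal_eq_orthPoly hW]
  exact hB.orthProj_eq (inf_le_left.trans hW) (fun g hg => conePoly_definite hβ hγ hg.1) hf hp hfp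

end ConeInner

/-! ### The Sobolev inner product -/

section Sobolev

variable {d s k m N : ℕ} {β : ℝ} {lam : ℕ → ℝ} {f g q : E d × ℝ → ℝ} {Y : E d → ℝ}

/-- Functions on `E d × ℝ` that are of class `C^s` near every point of the conic surface. -/
def coneSmooth (d s : ℕ) : Submodule ℝ (E d × ℝ → ℝ) where
  carrier := {g | ∀ p ∈ cone d, ContDiffAt ℝ s g p}
  zero_mem' _ _ := contDiffAt_const
  add_mem' hf hg p hp := (hf p hp).add (hg p hp)
  smul_mem' c _ hf p hp := (hf p hp).const_smul c

lemma conePoly_le_coneSmooth (d s N : ℕ) : conePoly d N ≤ coneSmooth d s :=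
  fun _ hg _ _ => (contDiff_of_mem_conePoly hg).contDiffAt

lemma tderiv_mem_coneContinuous (hk : k ≤ s) (hf : f ∈ coneSmooth d s) :
    tderiv k f ∈ coneContinuous d :=
  fun p hp => (continuousAt_tderiv hk (hf p hp)).continuousWithinAt

lemma baseTrace_mem_sphContinuous (hm : m ≤ s) (hf : f ∈ coneSmooth d s) :
    baseTrace d m f ∈ sphContinuous d :=
  coneSlice_mem_sphContinuous (tderiv_mem_coneContinuous hm hf) ⟨zero_le_one, le_rfl⟩

lemma eqOn_tderiv_sub (hk : k ≤ s) (hf : f ∈ coneSmooth d s) (hg : g ∈ coneSmooth d s) :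
    Set.EqOn (tderiv k (f - g)) (tderiv k f - tderiv k g) (cone d) :=
  have hks : (k : WithTop ℕ∞) ≤ s := mod_cast hk
  fun p hp => tderiv_sub ((hf p hp).of_le hks) ((hg p hp).of_le hks)

lemma eqOn_baseTrace_sub (hm : m ≤ s) (hf : f ∈ coneSmooth d s) (hg : g ∈ coneSmooth d s) :
    Set.EqOn (baseTrace d m (f - g)) (baseTrace d m f - baseTrace d m g) (Metric.sphere 0 1) :=
  fun _ hξ => eqOn_tderiv_sub hm hf hg (smul_mem_cone ⟨zero_le_one, le_rfl⟩ hξ)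

lemma coneConst_zero_right (h : -(d : ℝ) < β) : coneConst d β 0 = (β + d) / sphArea d := by
  have hpos : 0 < β + d := by linarith
  have := (Real.Gamma_pos_of_pos hpos).ne'
  rw [coneConst, add_zero, zero_add, Real.Gamma_one, Real.Gamma_add_one hpos.ne']
  field_simp

lemma sobInner_eq (hβ : -(d : ℝ) < β + s) (f g : E d × ℝ → ℝ) :
    sobInner d s β lam f g =
      (β + s + d)⁻¹ * coneInner d (β + s) 0 (tderiv s f) (tderiv s g) +
        ∑ m ∈ Finset.range s, lam m * sphInner d (baseTrace d m f) (baseTrace d m g) := by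
  have hpos : β + s + d ≠ 0 := by linarith
  rw [sobInner, coneInner, coneConst_zero_right hβ]
  simp only [sphInner, baseTrace_apply, Real.rpow_zero, mul_one]
  congr 1
  · field_simp
  · exact Finset.sum_congr rfl fun m _ => by ring

lemma exists_sobInner_eq_coneInner (hβ : -(d : ℝ) < β + s) (hg : g ∈ conePoly d (N - s)) :
    ∃ G ∈ conePoly d N, tderiv s G = g ∧ (∀ m < s, baseTrace d m G = 0) ∧
      ∀ f, sobInner d s β lam f G = (β + s + d)⁻¹ * coneInner d (β + s) 0 (tderiv s f) g := by
  obtain ⟨G, hG, hGg, hG0⟩ :=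
    exists_tderiv_eq_baseTrace_eq hg (Z := 0) fun m _ => Submodule.zero_mem _
  refine ⟨G, hG, hGg, hG0, fun f => ?_⟩
  rw [sobInner_eq hβ, hGg, Finset.sum_eq_zero, add_zero]
  intro m hm
  simp [hG0 m (Finset.mem_range.mp hm)]

lemma exists_sobInner_eq_sphInner (hβ : -(d : ℝ) < β + s) (hm : m < s)
    (hY : Y ∈ harmonicLT d (N - m)) :
    ∃ G ∈ conePoly d N, tderiv s G = 0 ∧ (∀ l < s, baseTrace d l G = (Pi.single m Y : ℕ → _) l) ∧
      ∀ f, sobInner d s β lam f G = lam m * sphInner d (baseTrace d m f) Y := by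
  obtain ⟨G, hG, hG0, hGY⟩ := exists_tderiv_eq_baseTrace_eq (s := s)
    (Submodule.zero_mem (conePoly d (N - s))) (Z := Pi.single m Y) fun l _ => by
      rcases eq_or_ne l m with rfl | hl
      · simpa using hY
      · simp [hl]
  refine ⟨G, hG, hG0, hGY, fun f => ?_⟩
  rw [sobInner_eq hβ, hG0, Finset.sum_eq_single_of_mem m (Finset.mem_range.mpr hm), hGY m hm,
    Pi.single_eq_same]
  · simp
  · intro l hl hlm
    simp [hGY l (Finset.mem_range.mp hl), hlm]

theorem mem_orthPoly_sobInner_iff (hβ : -(d : ℝ) < β + s) (hlam : ∀ m < s, lam m ≠ 0) :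
    q ∈ orthPoly d (sobInner d s β lam) k ↔ q ∈ conePoly d (k + 1) ∧
      (∀ g ∈ conePoly d (k - s), coneInner d (β + s) 0 (tderiv s q) g = 0) ∧
      ∀ m < s, ∀ Y ∈ harmonicLT d (k - m), sphInner d (baseTrace d m q) Y = 0 := by
  have hc : (β + s + d)⁻¹ ≠ 0 := inv_ne_zero (by linarith)
  constructor
  · rintro ⟨hq, hq0⟩
    refine ⟨hq, fun g hg => ?_, fun m hm Y hY => ?_⟩
    · obtain ⟨G, hG, -, -, inner_eq⟩ := exists_sobInner_eq_coneInner (lam := lam) hβ hg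
      exact (mul_eq_zero.mp ((inner_eq q).symm.trans (hq0 G hG))).resolve_left hc
    · obtain ⟨G, hG, -, -, inner_eq⟩ := exists_sobInner_eq_sphInner (lam := lam) hβ hm hY
      exact (mul_eq_zero.mp ((inner_eq q).symm.trans (hq0 G hG))).resolve_left (hlam m hm)
  · rintro ⟨hq, hcone, hbase⟩
    refine ⟨hq, fun r hr => ?_⟩
    rw [sobInner_eq hβ, hcone _ (tderiv_mem_conePoly s hr), mul_zero, zero_add]
    refine Finset.sum_eq_zero fun m hm => ?_
    rw [hbase m (Finset.mem_range.mp hm) _ (baseTrace_mem_harmonicLT m hr), mul_zero]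

theorem exists_mem_orthPoly_sobInner_sub_eq_zero [NeZero d] (hβ : -(d : ℝ) < β + s)
    (hlam : ∀ m < s, lam m ≠ 0) (k : ℕ) (hf : f ∈ coneSmooth d s) :
    ∃ p ∈ orthPoly d (sobInner d s β lam) k, ∀ q ∈ orthPoly d (sobInner d s β lam) k,
      sobInner d s β lam (f - p) q = 0 := by
  obtain ⟨g, hg, hg0, hfg⟩ :=
    (isSymmBilinOn_coneInner hβ neg_one_lt_zero).exists_proj_inf_orthogonal
      (conePoly_mono (Nat.sub_le_sub_right k.le_succ s)) (conePoly_le_coneContinuous d _)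
      (fun _ => conePoly_definite hβ neg_one_lt_zero) (tderiv_mem_coneContinuous le_rfl hf)
  have trace_proj (m : ℕ) (hm : m < s) :=
    (isSymmBilinOn_sphInner d).exists_proj_inf_orthogonal
      (harmonicLT_mono (Nat.sub_le_sub_right k.le_succ m)) (harmonicLT_le_sphContinuous d _)
      (fun _ => harmonicLT_definite) (baseTrace_mem_sphContinuous hm.le hf)
  choose! Z hZ hZ0 hfZ using trace_proj
  obtain ⟨p, hp, hpg, hpZ⟩ := exists_tderiv_eq_baseTrace_eq hg hZ
  have hp_smooth := conePoly_le_coneSmooth d s _ hp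
  refine ⟨p, (mem_orthPoly_sobInner_iff hβ hlam).mpr ⟨hp, hpg ▸ hg0, fun m hm => ?_⟩,
    fun q hq => ?_⟩
  · rw [hpZ m hm]
    exact hZ0 m hm
  · obtain ⟨hq, hq_cone, hq_base⟩ := (mem_orthPoly_sobInner_iff hβ hlam).mp hq
    rw [sobInner_eq hβ, coneInner_congr_left (eqOn_tderiv_sub le_rfl hf hp_smooth), hpg,
      hfg _ (tderiv_mem_conePoly s hq) hq_cone, mul_zero, zero_add]
    refine Finset.sum_eq_zero fun m hm => ?_
    rw [Finset.mem_range] at hm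
    rw [sphInner_congr_left (eqOn_baseTrace_sub hm.le hf hp_smooth), hpZ m hm,
      hfZ m hm _ (baseTrace_mem_harmonicLT m hq) (hq_base m hm), mul_zero]

lemma sobProj_spec [NeZero d] (hβ : -(d : ℝ) < β + s) (hlam : ∀ m < s, lam m ≠ 0) (k : ℕ)
    (hf : f ∈ coneSmooth d s) :
    sobProj d s β lam k f ∈ orthPoly d (sobInner d s β lam) k ∧
      ∀ q ∈ orthPoly d (sobInner d s β lam) k,
        sobInner d s β lam (f - sobProj d s β lam k f) q = 0 :=
  orthProj_spec_of_exists (exists_mem_orthPoly_sobInner_sub_eq_zero hβ hlam k hf)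

theorem tderiv_sobProj_add [NeZero d] (hβ : -(d : ℝ) < β + s) (hlam : ∀ m < s, lam m ≠ 0)
    (j : ℕ) (hf : f ∈ coneSmooth d s) :
    tderiv s (sobProj d s β lam (j + s) f) = coneProj d (β + s) 0 j (tderiv s f) := by
  obtain ⟨hp, hfp⟩ := sobProj_spec hβ hlam (j + s) hf
  set p := sobProj d s β lam (j + s) f
  obtain ⟨hp_mem, hp_cone, -⟩ := (mem_orthPoly_sobInner_iff hβ hlam).mp hp
  have hdeg : j + s + 1 - s = j + 1 := by omega
  have tderiv_mem : tderiv s p ∈ orthPoly d (coneInner d (β + s) 0) j :=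
    ⟨hdeg ▸ tderiv_mem_conePoly s hp_mem, by simpa using hp_cone⟩
  refine (coneProj_eq hβ neg_one_lt_zero (tderiv_mem_coneContinuous le_rfl hf) tderiv_mem
    fun r hr => ?_).symm
  obtain ⟨G, hG, hGr, hG0, inner_eq⟩ :=
    exists_sobInner_eq_coneInner (lam := lam) (N := j + s + 1) hβ (hdeg ▸ hr.1)
  have hG_orth : G ∈ orthPoly d (sobInner d s β lam) (j + s) := by
    refine (mem_orthPoly_sobInner_iff hβ hlam).mpr ⟨hG, ?_, fun m hm Y _ => ?_⟩
    · simpa [hGr] using hr.2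
    · simp [hG0 m hm]
  have inner_zero := (mul_eq_zero.mp ((inner_eq _).symm.trans (hfp G hG_orth))).resolve_left
    (inv_ne_zero (by linarith))
  rwa [← coneInner_congr_left
    (eqOn_tderiv_sub le_rfl hf (conePoly_le_coneSmooth d s _ hp_mem))]

theorem baseTrace_sobProj_add [NeZero d] (hβ : -(d : ℝ) < β + s) (hlam : ∀ m < s, lam m ≠ 0)
    (hm : m < s) (j : ℕ) (hf : f ∈ coneSmooth d s) :
    baseTrace d m (sobProj d s β lam (j + m) f) = sphProj d j (baseTrace d m f) := by
  obtain ⟨hp, hfp⟩ := sobProj_spec hβ hlam (j + m) hf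
  set p := sobProj d s β lam (j + m) f
  obtain ⟨hp_mem, -, hp_base⟩ := (mem_orthPoly_sobInner_iff hβ hlam).mp hp
  have hdeg : j + m + 1 - m = j + 1 := by omega
  have trace_mem : baseTrace d m p ∈ harmonicSubmodule d j :=
    mem_harmonicSubmodule_of_orthogonal (hdeg ▸ baseTrace_mem_harmonicLT m hp_mem)
      (by simpa using hp_base m hm)
  refine (sphProj_eq (baseTrace_mem_sphContinuous hm.le hf) trace_mem fun Y hY => ?_).symm
  obtain ⟨G, hG, hG0, hGY, inner_eq⟩ := exists_sobInner_eq_sphInner (lam := lam) (N := j + m + 1)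
    hβ hm (hdeg ▸ harmonicSubmodule_le_harmonicLT (Nat.lt_add_one j) hY)
  have hG_orth : G ∈ orthPoly d (sobInner d s β lam) (j + m) := by
    refine (mem_orthPoly_sobInner_iff hβ hlam).mpr ⟨hG, fun r _ => ?_, fun l hl Z hZ => ?_⟩
    · simp [hG0]
    · rcases eq_or_ne l m with rfl | hlm
      · rw [Nat.add_sub_cancel] at hZ
        rw [hGY l hl, Pi.single_eq_same, (isSymmBilinOn_sphInner d).symm _
          (harmonicSubmodule_le_sphContinuous d j hY) _ (harmonicLT_le_sphContinuous d j hZ),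
          sphInner_harmonicLT_eq_zero le_rfl hZ hY]
      · simp [hGY l hl, hlm]
  have inner_zero := (mul_eq_zero.mp ((inner_eq _).symm.trans (hfp G hG_orth))).resolve_left
    (hlam m hm)
  rwa [← sphInner_congr_left
    (eqOn_baseTrace_sub hm.le hf (conePoly_le_coneSmooth d s _ hp_mem))]

lemma sobProj_mem_conePoly (d s : ℕ) (β : ℝ) (lam : ℕ → ℝ) (k : ℕ) (f : E d × ℝ → ℝ) :
    sobProj d s β lam k f ∈ conePoly d (k + 1) := by
  rw [sobProj, orthProj]
  split_ifs with h
  · exact h.choose_spec.1.1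
  · exact Submodule.zero_mem _

lemma tderiv_sum_range_smul {F : ℕ → E d × ℝ → ℝ} (hF : ∀ k, F k ∈ conePoly d (k + 1))
    (c : ℕ → ℝ) (m N : ℕ) :
    tderiv m (∑ k ∈ Finset.range N, c k • F k) =
      ∑ j ∈ Finset.range (N - m), c (j + m) • tderiv m (F (j + m)) := by
  have low_degree {k : ℕ} (hk : k < m) : c k • tderiv m (F k) = 0 := by
    rw [tderiv_eq_zero_of_mem_conePoly (hF k) hk, smul_zero]
  rw [tderiv_sum_smul _ c fun k _ => contDiff_of_mem_conePoly (hF k)]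
  rcases le_total N m with hN | hN
  · rw [Nat.sub_eq_zero_of_le hN, Finset.sum_range_zero]
    exact Finset.sum_eq_zero fun k hk => low_degree ((Finset.mem_range.mp hk).trans_le hN)
  · obtain ⟨M, rfl⟩ := Nat.exists_eq_add_of_le hN
    rw [Finset.sum_range_add, Finset.sum_eq_zero fun k hk => low_degree (Finset.mem_range.mp hk),
      zero_add, Nat.add_sub_cancel_left]
    simp only [add_comm m]

theorem tderiv_sum_sobProj [NeZero d] (hβ : -(d : ℝ) < β + s) (hlam : ∀ m < s, lam m ≠ 0)
    (c : ℕ → ℝ) (N : ℕ) (hf : f ∈ coneSmooth d s) :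
    tderiv s (∑ k ∈ Finset.range N, c k • sobProj d s β lam k f) =
      ∑ j ∈ Finset.range (N - s), c (j + s) • coneProj d (β + s) 0 j (tderiv s f) := by
  simp only [tderiv_sum_range_smul (sobProj_mem_conePoly d s β lam · f),
    tderiv_sobProj_add hβ hlam _ hf]

theorem baseTrace_sum_sobProj [NeZero d] (hβ : -(d : ℝ) < β + s) (hlam : ∀ m < s, lam m ≠ 0)
    (c : ℕ → ℝ) (N : ℕ) (hm : m < s) (hf : f ∈ coneSmooth d s) :
    baseTrace d m (∑ k ∈ Finset.range N, c k • sobProj d s β lam k f) =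
      ∑ j ∈ Finset.range (N - m), c (j + m) • sphProj d j (baseTrace d m f) := by
  rw [baseTrace, tderiv_sum_range_smul (sobProj_mem_conePoly d s β lam · f), map_sum]
  simp only [← baseTrace_sobProj_add hβ hlam hm _ hf, map_smul]
  rfl

end Sobolev

end ConeSobolev

end

theorem mainTheorem6_general {d s : ℕ} [NeZero d] (hs : 1 ≤ s) {β : ℝ}
    (hβ : -(d : ℝ) - (s : ℝ) < β) {lam : ℕ → ℝ} (hlam : ∀ m < s, lam m ≠ 0) (c : ℕ → ℝ) (N : ℕ)
    {f : ConeSobolev.E d × ℝ → ℝ} (hf : ∀ p ∈ ConeSobolev.cone d, ContDiffAt ℝ s f p)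
    {x : ConeSobolev.E d} {t : ℝ} (hxt : ∀ v ∈ Set.uIcc 1 t, ContDiffAt ℝ s f (x, v)) :
    f (x, t) - (∑ k ∈ Finset.range N, c k • ConeSobolev.sobProj d s β lam k f) (x, t) =
      (∑ m ∈ Finset.range s, (t - 1) ^ m / (Nat.factorial m : ℝ) *
        (ConeSobolev.tderiv m f (x, 1) - (∑ j ∈ Finset.range (N - m),
          c (j + m) • ConeSobolev.sphProj d j fun ξ => ConeSobolev.tderiv m f (ξ, 1)) x)) +
      (-1 : ℝ) ^ s * ∫ v in t..1, (v - t) ^ (s - 1) / (Nat.factorial (s - 1) : ℝ) *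
        (ConeSobolev.tderiv s f (x, v) - (∑ j ∈ Finset.range (N - s),
          c (j + s) • ConeSobolev.coneProj d (β + s) 0 j (ConeSobolev.tderiv s f)) (x, v)) := by
  open ConeSobolev in
  have hβs : -(d : ℝ) < β + s := by linarith
  set Q := ∑ k ∈ Finset.range N, c k • sobProj d s β lam k f
  have hQ {p : E d × ℝ} : ContDiffAt ℝ s Q p := (contDiff_sum_smul _ c
    fun k _ => contDiff_of_mem_conePoly (sobProj_mem_conePoly d s β lam k f)).contDiffAt
  have base_eq {m : ℕ} (hm : m < s) : tderiv m (f - Q) (x, 1) = tderiv m f (x, 1) -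
      (∑ j ∈ Finset.range (N - m), c (j + m) • sphProj d j fun ξ => tderiv m f (ξ, 1)) x := by
    have hms : (m : WithTop ℕ∞) ≤ s := mod_cast hm.le
    rw [tderiv_sub ((hxt 1 Set.left_mem_uIcc).of_le hms) (hQ.of_le hms), ← baseTrace_apply Q,
      baseTrace_sum_sobProj hβs hlam c N hm hf]
    simp only [funext (baseTrace_apply f)]
  have remainder_eq {v : ℝ} (hv : v ∈ Set.uIcc 1 t) : tderiv s (f - Q) (x, v) =
      tderiv s f (x, v) - (∑ j ∈ Finset.range (N - s),
        c (j + s) • coneProj d (β + s) 0 j (tderiv s f)) (x, v) := by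
    rw [tderiv_sub (hxt v hv) hQ, tderiv_sum_sobProj hβs hlam c N hf]
  rw [← Pi.sub_apply, taylor_eq_sum_add_integral_tderiv (f := f - Q) hs
    fun v hv => (hxt v hv).sub hQ]
  congr 1
  · exact Finset.sum_congr rfl fun m hm => by rw [base_eq (Finset.mem_range.mp hm)]
  · congr 1
    refine intervalIntegral.integral_congr fun v hv => ?_
    simp only [remainder_eq (Set.uIcc_comm t 1 ▸ hv)]

theorem mainTheorem6 (d : ℕ) (hd : 2 ≤ d) (s : ℕ) (hs : 1 ≤ s) (β : ℝ)
    (hβ : -(d : ℝ) - (s : ℝ) < β) (lam : ℕ → ℝ) (hlam : ∀ k < s, 0 < lam k)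
    (η : ℝ → ℝ) (hη : ConeSobolev.IsAdmissibleCutoff η) (n : ℕ) (hn : 1 ≤ n)
    (U : Set (ConeSobolev.E d × ℝ)) (hU : IsOpen U) (hUc : ConeSobolev.solidCone d ⊆ U)
    (f : ConeSobolev.E d × ℝ → ℝ) (hf : ContDiffOn ℝ s f U)
    (x : ConeSobolev.E d) (t : ℝ) (hxt : (x, t) ∈ ConeSobolev.cone d) :
    f (x, t) - ConeSobolev.sobQ d s β lam η n f (x, t) =
      (∑ m ∈ Finset.range s, (t - 1) ^ m / (Nat.factorial m : ℝ) *
        (ConeSobolev.tderiv m f (x, 1) -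
          ConeSobolev.sphQ d η n m (fun ξ => ConeSobolev.tderiv m f (ξ, 1)) x)) +
      (-1 : ℝ) ^ s * ∫ v in t..1, (v - t) ^ (s - 1) / (Nat.factorial (s - 1) : ℝ) *
        (ConeSobolev.tderiv s f (x, v) -
          ConeSobolev.coneQ d (β + s) 0 η n s (ConeSobolev.tderiv s f) (x, v)) := by
  have : NeZero d := ⟨by omega⟩
  have smooth : ∀ p ∈ ConeSobolev.solidCone d, ContDiffAt ℝ s f p :=
    fun p hp => hf.contDiffAt (hU.mem_nhds (hUc hp))
  have main := mainTheorem6_general hs hβ (fun k hk => (hlam k hk).ne') (fun k => η ((k : ℝ) / n))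
    (2 * n + 1) (fun p hp => smooth p ⟨hp.1.le, hp.2.2⟩) (x := x) (t := t) fun v hv => by
      rw [Set.uIcc_of_ge hxt.2.2] at hv
      exact smooth _ ⟨hxt.1.le.trans hv.1, hv.2⟩
  simpa only [ConeSobolev.sobQ, ConeSobolev.sphQ, ConeSobolev.coneQ, Nat.cast_add] using main
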